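/- A Frölicher space is a set $X$ with a class of curves $\mathbb{R}\to X$ and a class of functions $X\to\mathbb{R}$ such that each class consists of all the maps whose composites with the members of the other class are $C^\infty$ maps $\mathbb{R}\to\mathbb{R}$; smooth maps are the maps that send curves to curves. Let $\mathcal{C}^\infty(Y,X)$ be the set of smooth maps $Y\to X$, where $\mathbb{R}^n$ has its usual structure, and let $X^Y$ be the exponential of the cartesian closed category of Frölicher spaces: the set $\mathcal{C}^\infty(Y,X)$, with as curves the maps $c$ for which $(s,y)\mapsto c(s)(y)$ is a smooth map $\mathbb{R}\times Y\to X$. A Weil algebra is a finite-dimensional local real algebra of the form $W=\mathcal{C}^\infty(\mathbb{R}^n)/I$, where $I$ is an ideal contained in the ideal of the functions vanishing at $0$. For $W_1=\mathcal{C}^\infty(\mathbb{R}^n)/I$ and $W_2=\mathcal{C}^\infty(\mathbb{R}^m)/J$, put $W_1\otimes_\infty W_2=\mathcal{C}^\infty(\mathbb{R}^n\times\mathbb{R}^m)/(I,J)$, where $(I,J)$ is the ideal generated by the pullbacks of $I$ and $J$ along the two projections. For a Frölicher space $X$ and a Weil algebra $W=\mathcal{C}^\infty(\mathbb{R}^n)/I$,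 the Weil prolongation $X\otimes W$ is the set of classes $[f]$ of $f\in\mathcal{C}^\infty(\mathbb{R}^n,X)$ for the relation: $f\equiv g$ if and only if $f(0)=g(0)$ and $\chi\circ f-\chi\circ g\in I$ for all $\chi\in\mathcal{C}^\infty(X,\mathbb{R})$. It carries the initial smooth structure with respect to the maps $\chi\otimes W:X\otimes W\to\mathbb{R}\otimes W=W$, $[f]\mapsto[\chi\circ f]$, for $\chi\in\mathcal{C}^\infty(X,\mathbb{R})$, where $W$ has the usual smooth structure of a finite-dimensional real vector space. A Frölicher space $X$ is called Weil-exponentiable if for every Frölicher space $Y$ and all Weil algebras $W_1,W_2$ as above $$(X\otimes(W_1\otimes_\infty W_2))^Y=(X\otimes W_1)^Y\otimes W_2$$ holds canonically, that is, there is an isomorphism of Frölicher spaces from the left side to the right side which, for every $\gamma\in\mathcal{C}^\infty(\mathbb{R}^n\times\mathbb{R}^m,X^Y)$, sends the element $y\mapsto[\gamma(\cdot,\cdot)(y)]$ to the class of $t\mapsto(y\mapsto[\gamma(\cdot,t)(y)])$, where $t\in\mathbb{R}^m$. **Proposition.** If $X$ is a Weil-exponentiable Frölicher space, then so is $X^Y$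 for every Frölicher space $Y$. -/

import Mathlib

open scoped ContDiff

universe u v

noncomputable section

/-- A Frölicher space: a set with a class of curves `ℝ → X` and a class of functions `X → ℝ` which
determine each other by the condition that their composites are smooth maps `ℝ → ℝ`. -/
structure FrolicherSpace : Type (u + 1) where
  carrier : Type u
  curves : Set (ℝ → carrier)
  functions : Set (carrier → ℝ)
  mem_curves : ∀ c : ℝ → carrier, c ∈ curves ↔ ∀ f ∈ functions, ContDiff ℝ ∞ (f ∘ c)
  mem_functions : ∀ f : carrier → ℝ, f ∈ functions ↔ ∀ c ∈ curves, ContDiff ℝ ∞ (f ∘ c)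

namespace FrolicherSpace

instance : CoeSort FrolicherSpace.{u} (Type u) := ⟨FrolicherSpace.carrier⟩

/-- The Frölicher structure generated by a set `C` of curves. -/
def ofCurves {S : Type u} (C : Set (ℝ → S)) : FrolicherSpace.{u} where
  carrier := S
  curves := {c | ∀ f : S → ℝ, (∀ d ∈ C, ContDiff ℝ ∞ (f ∘ d)) → ContDiff ℝ ∞ (f ∘ c)}
  functions := {f | ∀ d ∈ C, ContDiff ℝ ∞ (f ∘ d)}
  mem_curves _ := Iff.rfl
  mem_functions f := ⟨fun hf _ hc => hc f hf, fun h d hd => h d fun _ hf => hf d hd⟩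

/-- The Frölicher structure generated by a set `F` of functions, that is, the initial structure
with respect to the elements of `F`. -/
def ofFunctions {S : Type u} (F : Set (S → ℝ)) : FrolicherSpace.{u} where
  carrier := S
  curves := {c | ∀ f ∈ F, ContDiff ℝ ∞ (f ∘ c)}
  functions := {g | ∀ c : ℝ → S, (∀ f ∈ F, ContDiff ℝ ∞ (f ∘ c)) → ContDiff ℝ ∞ (g ∘ c)}
  mem_curves c := ⟨fun hc _ hg => hg c hc, fun h f hf => h f fun _ hd => hd f hf⟩
  mem_functions _ := Iff.rfl

/-- Smooth maps of Frölicher spaces: maps which send curves to curves. -/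
def IsSmooth {X : FrolicherSpace.{u}} {Y : FrolicherSpace.{v}} (f : X → Y) : Prop :=
  ∀ c ∈ X.curves, f ∘ c ∈ Y.curves

/-- The set of smooth maps `Y → X`. -/
def SmoothMap (Y X : FrolicherSpace.{u}) : Type u := {f : Y → X // IsSmooth f}

instance (Y X : FrolicherSpace.{u}) : CoeFun (SmoothMap Y X) fun _ => Y → X := ⟨Subtype.val⟩

/-- The exponential `X ^ Y` in the cartesian closed category of Frölicher spaces: the set of smooth
maps `Y → X`, with the structure given by those curves `c` for which `(s, y) ↦ c s y` is
a smooth map `ℝ × Y → X`. -/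
def exponential (X Y : FrolicherSpace.{u}) : FrolicherSpace.{u} :=
  ofCurves {c : ℝ → SmoothMap Y X |
    ∀ σ : ℝ → ℝ, ContDiff ℝ ∞ σ → ∀ b ∈ Y.curves, (fun s : ℝ => c (σ s) (b s)) ∈ X.curves}

instance (X Y : FrolicherSpace.{u}) : CoeFun (exponential X Y) fun _ => Y → X :=
  ⟨fun f : SmoothMap Y X => f.1⟩

end FrolicherSpace

/-- The real algebra `C^∞(ℝⁿ)` of smooth functions on `ℝⁿ`. -/
def smoothFunctions (n : ℕ) : Subalgebra ℝ ((Fin n → ℝ) → ℝ) where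
  carrier := {f | ContDiff ℝ ∞ f}
  mul_mem' {f g} hf hg := ContDiff.mul (show ContDiff ℝ ∞ f from hf) (show ContDiff ℝ ∞ g from hg)
  add_mem' {f g} hf hg := ContDiff.add (show ContDiff ℝ ∞ f from hf) (show ContDiff ℝ ∞ g from hg)
  algebraMap_mem' r := (contDiff_const : ContDiff ℝ ∞ fun _ : Fin n → ℝ => r)

/-- The ideal of the smooth functions on `ℝⁿ` which vanish at the origin. -/
def vanishingAtZero (n : ℕ) : Ideal (smoothFunctions n) where
  carrier := {f | f.1 0 = 0}
  add_mem' {f g} hf hg := by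
    change f.1 0 + g.1 0 = 0
    rw [show f.1 0 = 0 from hf, show g.1 0 = 0 from hg, add_zero]
  zero_mem' := rfl
  smul_mem' c f hf := by
    change c.1 0 * f.1 0 = 0
    rw [show f.1 0 = 0 from hf, mul_zero]

/-- The algebra homomorphism `C^∞(ℝᵏ) → C^∞(ℝⁿ)`, `f ↦ f ∘ p`, where `p : ℝⁿ → ℝᵏ` selects
the coordinates with the indices `e 0, …, e (k - 1)`. -/
def smoothFunctions.pullback {k n : ℕ} (e : Fin k → Fin n) :
    smoothFunctions k →ₐ[ℝ] smoothFunctions n where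
  toFun f := ⟨fun x => f.1 (fun i => x (e i)),
    ContDiff.comp (show ContDiff ℝ ∞ f.1 from f.2) (contDiff_pi.2 fun i => contDiff_apply ℝ ℝ (e i))⟩
  map_one' := rfl
  map_mul' _ _ := rfl
  map_zero' := rfl
  map_add' _ _ := rfl
  commutes' _ := rfl

/-- An algebra presented in the form `C^∞(ℝⁿ) / I`. -/
structure SmoothQuotient where
  dim : ℕ
  ideal : Ideal (smoothFunctions dim)

namespace SmoothQuotient

/-- The underlying algebra `C^∞(ℝⁿ) / I`. -/
abbrev Algebra (W : SmoothQuotient) : Type := smoothFunctions W.dim ⧸ W.ideal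

/-- `C^∞(ℝⁿ) / I` is a Weil algebra: it is a finite-dimensional local real algebra whose maximal
ideal consists of the classes of the functions vanishing at the origin (so that the residue field
is `ℝ`). -/
def IsWeil (W : SmoothQuotient) : Prop :=
  Module.Finite ℝ W.Algebra ∧ IsLocalRing W.Algebra ∧ W.ideal ≤ vanishingAtZero W.dim

/-- `C^∞(ℝⁿ)/I ⊗_∞ C^∞(ℝᵐ)/J = C^∞(ℝⁿ × ℝᵐ)/(I, J)`. The first `n` coordinates of `ℝⁿ⁺ᵐ` are
those of `ℝⁿ`, the last `m` are those of `ℝᵐ`. -/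
def tensor (V W : SmoothQuotient) : SmoothQuotient where
  dim := V.dim + W.dim
  ideal := V.ideal.map (smoothFunctions.pullback (Fin.castAdd W.dim)) ⊔
    W.ideal.map (smoothFunctions.pullback (Fin.natAdd V.dim))

/-- `ℝ ⊗ W = C^∞(ℝⁿ)/I` with its smooth structure as a real vector space, generated by the
linear functionals (for a finite-dimensional `W` it is the usual structure of `ℝᵏ`). -/
def space (W : SmoothQuotient) : FrolicherSpace.{0} :=
  FrolicherSpace.ofFunctions {f : W.Algebra → ℝ | ∃ l : W.Algebra →ₗ[ℝ] ℝ, ∀ a, f a = l a}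

end SmoothQuotient

namespace FrolicherSpace

/-- The set `C^∞(ℝⁿ, X)` of smooth maps `ℝⁿ → X`: the maps whose composites with all functions on
`X` belong to `C^∞(ℝⁿ)`, the class of functions of the Frölicher space `ℝⁿ`. -/
def Plot (n : ℕ) (X : FrolicherSpace.{u}) : Type u :=
  {f : (Fin n → ℝ) → X // ∀ χ ∈ X.functions, ContDiff ℝ ∞ (χ ∘ f)}

instance (n : ℕ) (X : FrolicherSpace.{u}) : CoeFun (Plot n X) fun _ => (Fin n → ℝ) → X :=
  ⟨Subtype.val⟩

/-- `χ ∘ f` as an element of `C^∞(ℝⁿ)`. -/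
def Plot.compFunction {n : ℕ} {X : FrolicherSpace.{u}} (χ : X.functions) (f : Plot n X) :
    smoothFunctions n :=
  ⟨χ.1 ∘ f.1, f.2 χ.1 χ.2⟩

/-- The relation `f ≡ g mod I` on `C^∞(ℝⁿ, X)`. -/
def jetSetoid (X : FrolicherSpace.{u}) (W : SmoothQuotient) : Setoid (Plot W.dim X) where
  r f g := f 0 = g 0 ∧
    ∀ χ : X.functions, Plot.compFunction χ f - Plot.compFunction χ g ∈ W.ideal
  iseqv :=
    { refl := fun f => ⟨rfl, fun χ => by rw [sub_self]; exact W.ideal.zero_mem⟩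
      symm := fun h => ⟨h.1.symm, fun χ => by rw [← neg_sub]; exact W.ideal.neg_mem (h.2 χ)⟩
      trans := fun h h' => ⟨h.1.trans h'.1, fun χ => by
        rw [← sub_add_sub_cancel]; exact W.ideal.add_mem (h.2 χ) (h'.2 χ)⟩ }

/-- The underlying set of `X ⊗ W`. -/
def Jet (X : FrolicherSpace.{u}) (W : SmoothQuotient) : Type u := Quotient (jetSetoid X W)

/-- The class of `f ∈ C^∞(ℝⁿ, X)` in `X ⊗ W`. -/
def jet {X : FrolicherSpace.{u}} (W : SmoothQuotient) (f : Plot W.dim X) : Jet X W :=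
  Quotient.mk (jetSetoid X W) f

/-- The map `χ ⊗ W : X ⊗ W → ℝ ⊗ W`, `[f] ↦ [χ ∘ f]`. -/
def Jet.map {X : FrolicherSpace.{u}} {W : SmoothQuotient} (χ : X.functions) :
    Jet X W → W.space :=
  Quotient.lift
    (fun f : Plot W.dim X => (Ideal.Quotient.mk W.ideal (Plot.compFunction χ f) : W.Algebra))
    fun _ _ h => Ideal.Quotient.eq.2 (h.2 χ)

/-- The Weil prolongation `X ⊗ W`, with the initial smooth structure with respect to the maps
`χ ⊗ W : X ⊗ W → ℝ ⊗ W`, where `χ` ranges over the functions on `X`. -/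
def prolong (X : FrolicherSpace.{u}) (W : SmoothQuotient) : FrolicherSpace.{u} :=
  ofFunctions {f : Jet X W → ℝ | ∃ χ : X.functions, ∃ h ∈ W.space.functions, f = h ∘ Jet.map χ}

/-- For `γ ∈ C^∞(ℝⁿ, X ^ Y)` and `y ∈ Y`, the smooth map `x ↦ γ x y`. -/
def Plot.eval {n : ℕ} {X Y : FrolicherSpace.{u}} (γ : Plot n (exponential X Y)) (y : Y) :
    Plot n X :=
  ⟨fun x => γ x y, fun χ hχ =>
    γ.2 (fun f : SmoothMap Y X => χ (f y)) fun _ hc =>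
      (X.mem_curves _).1
        (hc id contDiff_id (fun _ => y) ((Y.mem_curves _).2 fun _ _ => contDiff_const)) χ hχ⟩

/-- For `f ∈ C^∞(ℝⁿ × ℝᵐ, X)` and `t ∈ ℝᵐ`, the smooth map `x ↦ f (x, t)`. -/
def Plot.slice {n m : ℕ} {X : FrolicherSpace.{u}} (f : Plot (n + m) X) (t : Fin m → ℝ) :
    Plot n X :=
  ⟨fun x => f (Fin.append x t), fun χ hχ => (f.2 χ hχ).comp (contDiff_pi.2 fun i => by
    refine Fin.addCases (fun j => ?_) (fun j => ?_) i
    · simpa only [Fin.append_left] using contDiff_apply ℝ ℝ j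
    · simpa only [Fin.append_right] using contDiff_const)⟩

/-- The identity `(X ⊗ (W₁ ⊗_∞ W₂)) ^ Y = (X ⊗ W₁) ^ Y ⊗ W₂` holds: there is an isomorphism `Θ` of
Frölicher spaces from the left side to the right side which is the canonical one, that is, each
`γ ∈ C^∞(ℝⁿ × ℝᵐ, X ^ Y)` determines elements of both sides, namely
`y ↦ [γ(·, ·)(y)] ∈ X ⊗ (W₁ ⊗_∞ W₂)` and the class of `t ↦ (y ↦ [γ(·, t)(y)] ∈ X ⊗ W₁)`,
and `Θ` sends the former to the latter. -/
def ExponentialLaw (X Y : FrolicherSpace.{u}) (W₁ W₂ : SmoothQuotient) : Prop :=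
  ∃ Θ : exponential (X.prolong (W₁.tensor W₂)) Y ≃ (exponential (X.prolong W₁) Y).prolong W₂,
    IsSmooth Θ ∧ IsSmooth Θ.symm ∧
    ∀ γ : Plot (W₁.dim + W₂.dim) (exponential X Y),
      ∃ (φ : exponential (X.prolong (W₁.tensor W₂)) Y)
        (g : Plot W₂.dim (exponential (X.prolong W₁) Y)),
        (∀ y : Y, φ y = jet (W₁.tensor W₂) (γ.eval y)) ∧
        (∀ (t : Fin W₂.dim → ℝ) (y : Y),
          g t y = jet W₁ ((γ.eval y).slice t)) ∧
        Θ φ = jet W₂ g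

/-- `X` is Weil-exponentiable. -/
def WeilExponentiable (X : FrolicherSpace.{u}) : Prop :=
  ∀ (Y : FrolicherSpace.{u}) (W₁ W₂ : SmoothQuotient), W₁.IsWeil → W₂.IsWeil →
    ExponentialLaw X Y W₁ W₂

end FrolicherSpace

end

noncomputable section

open Filter Topology MeasureTheory FourierTransform

/-! Taking `W₁ = ℝ` in the hypothesis on `X` gives a canonical isomorphism `X^Y ⊗ W ≅ (X ⊗ W)^Y`
(`WeilExponentiable.exists_iso`). Then, canonically at each step, `(X^Y ⊗ (W₁ ⊗ W₂))^Z ≅ ((X ⊗ (W₁ ⊗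
W₂))^Y)^Z ≅ (X ⊗ (W₁ ⊗ W₂))^(Y × Z) ≅ (X ⊗ W₁)^(Y × Z) ⊗ W₂ ≅ ((X ⊗ W₁)^Y)^Z ⊗ W₂ ≅ (X^Y ⊗ W₁)^Z ⊗
W₂`, where the middle isomorphism is the hypothesis with exponent `Y × Z`. It remains to know that
`W₁ ⊗_∞ W₂` is a Weil algebra (`IsWeil.tensor`, from Hadamard's lemma) and that currying is an
isomorphism.

Currying is the analytic core. The structure of `X^Y` is only generated by the curves with smooth
adjoint, so it must be shown that no further curves arise (`mem_curves_exponential`). For a curve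
`c` of `X^Y`, a curve `b` of `Y` and a function `χ` on `X`, put `f s t = χ (c s (b t))`. By Boman's
theorem in the plane, every functional `h ↦ l (∂ₜᵏ χ (h (b t)))`, with `l` in the dual of `C([-R,
R])`, is a function on `X^Y`. Hence `s ↦ ∂ₜᵏ f s` is weakly smooth in `C([-R, R])`, and
Banach–Steinhaus bounds its derivatives on compact sets. Locally bounded pure partial derivatives
suffice for joint smoothness, by decay of the Fourier transform. -/

/-! ### The special curve lemma and bounds for partial derivatives. -/

theorem exists_bound_iteratedFDeriv {f : ℝ → ℝ} (hf : ContDiff ℝ ∞ f)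
    (hc : HasCompactSupport f) (n : ℕ) :
    ∃ M, 0 ≤ M ∧ ∀ i ≤ n, ∀ x, ‖iteratedFDeriv ℝ i f x‖ ≤ M := by
  have h : ∀ i, ∃ M, ∀ x, ‖iteratedFDeriv ℝ i f x‖ ≤ M := fun i =>
    (hc.iteratedFDeriv i).exists_bound_of_continuous
      (hf.continuous_iteratedFDeriv (m := i) (by exact_mod_cast le_top))
  choose M hM using h
  have hM0 : ∀ i, 0 ≤ M i := fun i => (norm_nonneg _).trans (hM i 0)
  refine ⟨∑ i ∈ Finset.range (n + 1), M i, Finset.sum_nonneg fun i _ => hM0 i, fun i hi x => ?_⟩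
  exact (hM i x).trans
    (Finset.single_le_sum (f := M) (fun i _ => hM0 i) (Finset.mem_range.2 (by omega)))

/-- A bump function centred at `2⁻ᵏ` whose supports are pairwise disjoint. -/
def dyadicBump (k : ℕ) : ContDiffBump ((1 / 2 : ℝ) ^ k) where
  rIn := (1 / 2 : ℝ) ^ k / 16
  rOut := (1 / 2 : ℝ) ^ k / 8
  rIn_pos := by positivity
  rIn_lt_rOut := by
    have : (0 : ℝ) < (1 / 2) ^ k := by positivity
    linarith

theorem dyadicBump_eq_zero {k l : ℕ} (h : l ≠ k) {x : ℝ}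
    (hx : |x - (1 / 2 : ℝ) ^ k| < (1 / 2) ^ k / 16) : dyadicBump l x = 0 := by
  apply ContDiffBump.zero_of_le_dist
  change (1 / 2 : ℝ) ^ l / 8 ≤ |x - (1 / 2) ^ l|
  have hk : (0 : ℝ) < (1 / 2) ^ k := by positivity
  have hl : (0 : ℝ) < (1 / 2) ^ l := by positivity
  rw [abs_lt] at hx
  rcases lt_or_gt_of_ne h with h | h
  · have : (1 / 2 : ℝ) ^ k ≤ (1 / 2) ^ (l + 1) :=
      pow_le_pow_of_le_one (by norm_num) (by norm_num) h
    rw [pow_succ] at this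
    rw [abs_sub_comm]
    exact le_trans (by linarith) (le_abs_self _)
  · have : (1 / 2 : ℝ) ^ l ≤ (1 / 2) ^ (k + 1) :=
      pow_le_pow_of_le_one (by norm_num) (by norm_num) h
    rw [pow_succ] at this
    exact le_trans (by linarith) (le_abs_self _)

/-- The special curve lemma: sufficiently small line segments are the germs of one smooth curve at
the points of a null sequence. -/
theorem exists_smooth_eventuallyEq_affine :
    ∃ ε : ℕ → ℝ, (∀ k, 0 < ε k) ∧ ∀ a b : ℕ → ℝ, (∀ k, |a k| ≤ ε k) → (∀ k, |b k| ≤ ε k) →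
      ∃ σ : ℝ → ℝ, ContDiff ℝ ∞ σ ∧
        ∀ k, ∀ᶠ x in 𝓝 ((1 / 2 : ℝ) ^ k), σ x = a k + b k * (x - (1 / 2) ^ k) := by
  have key : ∀ k : ℕ, ∃ ε : ℝ, 0 < ε ∧ ∀ a b : ℝ, |a| ≤ ε → |b| ≤ ε → ∀ i ≤ k, ∀ x,
      ‖iteratedFDeriv ℝ i
        (fun x => dyadicBump k x * (a + b * (x - (1 / 2 : ℝ) ^ k))) x‖ ≤ (1 / 2) ^ k := by
    intro k
    have hP : ContDiff ℝ ∞ (dyadicBump k) := (dyadicBump k).contDiff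
    have hQ : ContDiff ℝ ∞ fun x => dyadicBump k x * (x - (1 / 2 : ℝ) ^ k) :=
      hP.mul (contDiff_id.sub contDiff_const)
    obtain ⟨M, hM0, hM⟩ := exists_bound_iteratedFDeriv hP (dyadicBump k).hasCompactSupport k
    obtain ⟨N, hN0, hN⟩ := exists_bound_iteratedFDeriv hQ
      (dyadicBump k).hasCompactSupport.mul_right k
    -- `M` and `N` bound the derivatives up to order `k` of the constant and the linear part; the `+
    -- 1` keeps the denominator positive.
    refine ⟨(1 / 2) ^ k / (M + N + 1), by positivity, fun a b ha hb i hi x => ?_⟩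
    have hi' : (i : WithTop ℕ∞) ≤ ∞ := by exact_mod_cast le_top
    have e : (fun x => dyadicBump k x * (a + b * (x - (1 / 2 : ℝ) ^ k))) =
        (a • ⇑(dyadicBump k)) + b • fun x => dyadicBump k x * (x - (1 / 2 : ℝ) ^ k) := by
      ext x
      simp only [Pi.add_apply, Pi.smul_apply, smul_eq_mul]
      ring
    have hP' : ContDiff ℝ i (a • ⇑(dyadicBump k)) := (hP.const_smul a).of_le hi'
    have hQ' : ContDiff ℝ i (b • fun x => dyadicBump k x * (x - (1 / 2 : ℝ) ^ k)) :=
      (hQ.const_smul b).of_le hi'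
    rw [e, iteratedFDeriv_add_apply hP'.contDiffAt hQ'.contDiffAt,
      iteratedFDeriv_const_smul_apply (hP.of_le hi').contDiffAt,
      iteratedFDeriv_const_smul_apply (hQ.of_le hi').contDiffAt]
    have h1 : (1 / 2 : ℝ) ^ k / (M + N + 1) * (M + N) ≤ (1 / 2) ^ k := by
      rw [div_mul_eq_mul_div, div_le_iff₀ (by positivity)]
      have : (0 : ℝ) < (1 / 2) ^ k := by positivity
      nlinarith
    refine (norm_add_le _ _).trans (le_trans ?_ h1)
    rw [norm_smul, norm_smul, mul_add]
    exact add_le_add (mul_le_mul ha (hM i hi x) (norm_nonneg _) (by positivity))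
      (mul_le_mul hb (hN i hi x) (norm_nonneg _) (by positivity))
  choose ε hε h using key
  refine ⟨ε, hε, fun a b ha hb => ?_⟩
  refine ⟨fun x => ∑' k, dyadicBump k x * (a k + b k * (x - (1 / 2 : ℝ) ^ k)), ?_, fun k => ?_⟩
  · refine contDiff_tsum_of_eventually (N := ⊤) (v := fun _ k => (1 / 2 : ℝ) ^ k) (fun k => ?_)
      (fun _ _ => summable_geometric_two) fun i _ => ?_
    · exact (dyadicBump k).contDiff.mul
        (contDiff_const.add (contDiff_const.mul (contDiff_id.sub contDiff_const)))
    · rw [Nat.cofinite_eq_atTop]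
      -- The `k`-th term is controlled only up to order `k`, so for derivatives of order `i` the
      -- finitely many terms with `k < i` are ignored.
      filter_upwards [eventually_ge_atTop i] with k hk x
      exact h k (a k) (b k) (ha k) (hb k) i hk x
  -- On this inner ball the `k`-th bump is `1` and all others vanish.
  · have : (0 : ℝ) < (1 / 2) ^ k / 16 := by positivity
    filter_upwards [Metric.ball_mem_nhds _ this] with x hx
    rw [tsum_eq_single k fun l hl => by rw [dyadicBump_eq_zero hl hx, zero_mul],
      (dyadicBump k).one_of_mem_closedBall (Metric.ball_subset_closedBall hx), one_mul]

/-- A function on the plane which is smooth along all smooth curves. -/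
def ArcSmooth (f : ℝ → ℝ → ℝ) : Prop :=
  ∀ σ τ : ℝ → ℝ, ContDiff ℝ ∞ σ → ContDiff ℝ ∞ τ → ContDiff ℝ ∞ fun u => f (σ u) (τ u)

/-- The partial derivatives in the first variable are bounded on compact sets. -/
def BoundedDerivs (f : ℝ → ℝ → ℝ) : Prop :=
  ∀ (j : ℕ) (R : ℝ), ∃ C, ∀ s t : ℝ, |s| ≤ R → |t| ≤ R →
    |iteratedDeriv j (fun s => f s t) s| ≤ C

theorem ArcSmooth.swap {f : ℝ → ℝ → ℝ} (hf : ArcSmooth f) : ArcSmooth fun s t => f t s :=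
  fun σ τ hσ hτ => hf τ σ hτ hσ

theorem ArcSmooth.contDiff_left {f : ℝ → ℝ → ℝ} (hf : ArcSmooth f) (t : ℝ) :
    ContDiff ℝ ∞ fun s => f s t := hf _ _ contDiff_id contDiff_const

theorem iteratedDeriv_comp_affine {g : ℝ → ℝ} (hg : ContDiff ℝ ∞ g) (j : ℕ) (a b c : ℝ) :
    iteratedDeriv j (fun x => g (a + b * (x - c))) c = b ^ j * iteratedDeriv j g a := by
  have h1 := iteratedDeriv_comp_sub_const j (fun y => g (a + b * y)) c
  have h2 := iteratedDeriv_comp_const_mul (n := j) (f := fun z => g (a + z))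
    ((hg.comp (contDiff_const.add contDiff_id)).of_le (by exact_mod_cast le_top)) b
  have h3 := iteratedDeriv_comp_const_add j g a
  rw [h3] at h2
  rw [h1, h2]
  simp

/-- If a derivative were unbounded near a point, bad points converging fast to it would lie on one
smooth curve, crossed at the times `2⁻ᵏ` along short horizontal segments. The derivatives of the
composite at `2⁻ᵏ` would then diverge, although they are continuous at `0`. Compactness turns the
local bounds into bounds on squares. -/
theorem ArcSmooth.boundedDerivs {f : ℝ → ℝ → ℝ} (hf : ArcSmooth f) : BoundedDerivs f := by
  intro j R
  obtain ⟨ε, hε, hcurve⟩ := exists_smooth_eventuallyEq_affine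
  have hloc : ∀ p : ℝ × ℝ, ∃ U ∈ 𝓝 p, ∃ C, ∀ q ∈ U,
      |iteratedDeriv j (fun s => f s q.2) q.1| ≤ C := by
    rintro ⟨s₀, t₀⟩
    by_contra! hcon
    -- The segment is run through with velocity `ε k`, which costs a factor `ε k ^ j` in the `j`-th
    -- derivative; the threshold compensates for it.
    have hk : ∀ k : ℕ, ∃ q : ℝ × ℝ, (|q.1 - s₀| ≤ ε k ∧ |q.2 - t₀| ≤ ε k) ∧
        k / ε k ^ j < |iteratedDeriv j (fun s => f s q.2) q.1| := by
      intro k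
      obtain ⟨q, hq, hq'⟩ := hcon (Metric.closedBall s₀ (ε k) ×ˢ Metric.closedBall t₀ (ε k))
        (prod_mem_nhds (Metric.closedBall_mem_nhds _ (hε k)) (Metric.closedBall_mem_nhds _ (hε k)))
        (k / ε k ^ j)
      exact ⟨q, hq, hq'⟩
    choose q hq hq' using hk
    obtain ⟨σ, hσ, hσ'⟩ := hcurve (fun k => (q k).1 - s₀) ε (fun k => (hq k).1)
      (fun k => (abs_of_pos (hε k)).le)
    obtain ⟨τ, hτ, hτ'⟩ := hcurve (fun k => (q k).2 - t₀) 0 (fun k => (hq k).2)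
      (fun k => by simpa using (hε k).le)
    have hg := hf (fun u => s₀ + σ u) (fun u => t₀ + τ u) (contDiff_const.add hσ)
      (contDiff_const.add hτ)
    set g := fun u => f (s₀ + σ u) (t₀ + τ u) with hgdef
    have hval : ∀ k : ℕ, (k : ℝ) < |iteratedDeriv j g ((1 / 2) ^ k)| := by
      intro k
      have : g =ᶠ[𝓝 ((1 / 2 : ℝ) ^ k)]
          fun u => f ((q k).1 + ε k * (u - (1 / 2) ^ k)) (q k).2 := by
        filter_upwards [hσ' k, hτ' k] with u h1 h2
        simp only [hgdef, h1, h2, Pi.zero_apply]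
        congr 1 <;> ring
      rw [this.iteratedDeriv_eq, iteratedDeriv_comp_affine (hf.contDiff_left _), abs_mul,
        abs_of_pos (pow_pos (hε k) j), mul_comm, ← div_lt_iff₀ (pow_pos (hε k) j)]
      exact hq' k
    have hcont : Continuous (iteratedDeriv j g) :=
      hg.continuous_iteratedDeriv j (by exact_mod_cast le_top)
    have hlim : Tendsto (fun k : ℕ => |iteratedDeriv j g ((1 / 2) ^ k)|) atTop
        (𝓝 |iteratedDeriv j g 0|) :=
      ((hcont.tendsto 0).comp
        (tendsto_pow_atTop_nhds_zero_of_lt_one (by norm_num) (by norm_num))).abs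
    exact not_tendsto_nhds_of_tendsto_atTop
      (tendsto_atTop_mono (fun k => (hval k).le) tendsto_natCast_atTop_atTop) _ hlim
  have hK : IsCompact (Metric.closedBall (0 : ℝ) R ×ˢ Metric.closedBall (0 : ℝ) R) :=
    (isCompact_closedBall _ _).prod (isCompact_closedBall _ _)
  obtain ⟨C, hC⟩ : ∃ C, ∀ q ∈ Metric.closedBall (0 : ℝ) R ×ˢ Metric.closedBall (0 : ℝ) R,
      |iteratedDeriv j (fun s => f s q.2) q.1| ≤ C := by
    refine hK.induction_on (p := fun S => ∃ C, ∀ q ∈ S,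
      |iteratedDeriv j (fun s => f s q.2) q.1| ≤ C) ⟨0, by simp⟩ ?_ ?_ ?_
    · rintro S T hST ⟨C, hC⟩
      exact ⟨C, fun q hq => hC q (hST hq)⟩
    · rintro S T ⟨C, hC⟩ ⟨D, hD⟩
      refine ⟨max C D, fun q hq => ?_⟩
      rcases hq with hq | hq
      · exact (hC q hq).trans (le_max_left _ _)
      · exact (hD q hq).trans (le_max_right _ _)
    · intro p _
      obtain ⟨U, hU, C, hC⟩ := hloc p
      exact ⟨U, mem_nhdsWithin_of_mem_nhds hU, C, hC⟩
  refine ⟨C, fun s t hs ht => hC (s, t) ⟨?_, ?_⟩⟩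
  · simpa using hs
  · simpa using ht

/-! ### Fourier decay and Boman's theorem in the plane. -/

/-- Each derivative is a pointwise limit of difference quotients with steps `1 / (n + 1)`. Joint
continuity of the derivatives is not yet known, and measurability is enough for integrating them. -/
theorem measurable_iteratedDeriv_left {f : ℝ → ℝ → ℝ} (hf : ∀ t, ContDiff ℝ ∞ fun s => f s t)
    (hm : Measurable fun p : ℝ × ℝ => f p.1 p.2) (j : ℕ) :
    Measurable fun p : ℝ × ℝ => iteratedDeriv j (fun s => f s p.2) p.1 := by
  induction j with
  | zero => simpa using hm
  | succ j ih =>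
    refine measurable_of_tendsto_metrizable (f := fun (n : ℕ) (p : ℝ × ℝ) =>
      (1 / ((n : ℝ) + 1))⁻¹ • (iteratedDeriv j (fun s => f s p.2) (p.1 + 1 / ((n : ℝ) + 1)) -
        iteratedDeriv j (fun s => f s p.2) p.1)) (fun n => ?_) ?_
    · have h : Measurable fun p : ℝ × ℝ =>
          iteratedDeriv j (fun s => f s p.2) (p.1 + 1 / ((n : ℝ) + 1)) :=
        ih.comp (f := fun p : ℝ × ℝ => (p.1 + 1 / ((n : ℝ) + 1), p.2)) (by fun_prop)
      exact measurable_const.mul (h.sub ih)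
    · rw [tendsto_pi_nhds]
      rintro ⟨s, t⟩
      have hd : HasDerivAt (iteratedDeriv j fun s => f s t)
          (iteratedDeriv (j + 1) (fun s => f s t) s) s := by
        rw [iteratedDeriv_succ]
        exact ((hf t).differentiable_iteratedDeriv j
          (by exact_mod_cast WithTop.coe_lt_top _) s).hasDerivAt
      refine hd.tendsto_slope_zero_right.comp
        (tendsto_nhdsWithin_iff.2 ⟨tendsto_one_div_add_atTop_nhds_zero_nat, ?_⟩)
      exact Eventually.of_forall fun n => by
        change (0 : ℝ) < 1 / ((n : ℝ) + 1)
        positivity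

/-- Integration by parts against the character; only a derivative in the direction `e` is needed. -/
theorem fourier_lineDeriv {V : Type*} [NormedAddCommGroup V] [InnerProductSpace ℝ V]
    [FiniteDimensional ℝ V] [MeasurableSpace V] [BorelSpace V] {f f' : V → ℂ} {e : V}
    (hf : Integrable f) (hf' : Integrable f') (h : ∀ x, HasLineDerivAt ℝ f (f' x) x e) (w : V) :
    𝓕 f' w = (2 * Real.pi * Complex.I * inner ℝ e w : ℂ) * 𝓕 f w := by
  have hlin : ∀ (g : V → ℂ), 𝓕 g w =
      ∫ x, g x * Complex.exp (↑(-2 * Real.pi * inner ℝ x w) * Complex.I) := by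
    intro g
    rw [Real.fourier_eq']
    simp only [smul_eq_mul, mul_comm]
  have hcont : Continuous fun x : V =>
      Complex.exp (↑(-2 * Real.pi * inner ℝ x w) * Complex.I) := by fun_prop
  have hint : ∀ g : V → ℂ, Integrable g → Integrable fun x =>
      g x * Complex.exp (↑(-2 * Real.pi * inner ℝ x w) * Complex.I) := by
    intro g hg
    refine hg.mul_bdd (c := 1) hcont.aestronglyMeasurable (Eventually.of_forall fun x => ?_)
    rw [Complex.norm_exp_ofReal_mul_I]
  have hd : ∀ x : V, HasLineDerivAt ℝ
      (fun x : V => Complex.exp (↑(-2 * Real.pi * inner ℝ x w) * Complex.I))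
      (Complex.exp (↑(-2 * Real.pi * inner ℝ x w) * Complex.I) *
        (-(2 * Real.pi * Complex.I * inner ℝ e w))) x e := by
    intro x
    unfold HasLineDerivAt
    have h1 : HasDerivAt (fun t : ℝ => -2 * Real.pi * inner ℝ (x + t • e) w)
        (-2 * Real.pi * inner ℝ e w) 0 := by
      have : (fun t : ℝ => -2 * Real.pi * inner ℝ (x + t • e) w) =
          fun t : ℝ => -2 * Real.pi * (inner ℝ x w + t * inner ℝ e w) := by
        ext t
        rw [inner_add_left, real_inner_smul_left]
      rw [this]
      exact ((hasDerivAt_mul_const _).const_add _).const_mul _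
    have h2 := ((h1.ofReal_comp).mul_const Complex.I).cexp
    refine h2.congr_deriv ?_
    rw [zero_smul, add_zero]
    push_cast
    ring
  have := integral_bilinear_hasLineDerivAt_right_eq_neg_left_of_integrable
    (μ := (volume : Measure V)) (B := ContinuousLinearMap.mul ℝ ℂ) (v := e)
    (f := f) (f' := f') (g := fun x => Complex.exp (↑(-2 * Real.pi * inner ℝ x w) * Complex.I))
    (g' := fun x => Complex.exp (↑(-2 * Real.pi * inner ℝ x w) * Complex.I) *
        (-(2 * Real.pi * Complex.I * inner ℝ e w))) (hint f' hf')
    (by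
      simp only [ContinuousLinearMap.mul_apply', ← mul_assoc]
      exact (hint f hf).mul_const _) (hint f hf) (fun x _ => h x) (fun x _ => hd x)
  simp only [ContinuousLinearMap.mul_apply', ← mul_assoc] at this
  rw [integral_mul_const] at this
  rw [hlin, hlin, ← neg_eq_iff_eq_neg.2 this]
  ring

/-- The Euclidean plane. -/
abbrev Plane := EuclideanSpace ℝ (Fin 2)

theorem Plane.norm_le (x : Plane) : ‖x‖ ≤ |x 0| + |x 1| := by
  rw [EuclideanSpace.norm_eq, Fin.sum_univ_two, Real.sqrt_le_left (by positivity)]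
  simp only [Real.norm_eq_abs]
  nlinarith [abs_nonneg (x 0), abs_nonneg (x 1)]

/-- The derivatives in the first variable are measurable, bounded and supported in a fixed compact
set, hence integrable. Integrating by parts `j` times yields decay of order `j` in the dual
coordinate. -/
theorem fourier_decay_of_bounded_derivs {f : ℝ → ℝ → ℝ} {R : ℝ}
    (h0 : ∀ s t, R ≤ |s| ∨ R ≤ |t| → f s t = 0)
    (hf : ∀ t, ContDiff ℝ ∞ fun s => f s t)
    (hm : Measurable fun p : ℝ × ℝ => f p.1 p.2) (hb : BoundedDerivs f)
    {i k : Fin 2} (hik : i ≠ k) :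
    Integrable (fun x : Plane => (f (x i) (x k) : ℂ)) ∧
    ∀ j : ℕ, ∃ C, ∀ w : Plane,
      |w i| ^ j * ‖𝓕 (fun x : Plane => (f (x i) (x k) : ℂ)) w‖ ≤ C := by
  set G : ℕ → Plane → ℂ := fun j x => ((iteratedDeriv j (fun s => f s (x k)) (x i) : ℝ) : ℂ) with hG
  have hzero : ∀ j (x : Plane), R < |x i| ∨ R < |x k| → G j x = 0 := by
    intro j x hx
    have : (fun s => f s (x k)) =ᶠ[𝓝 (x i)] fun _ => 0 := by
      rcases hx with hx | hx
      · have : {s : ℝ | R < |s|} ∈ 𝓝 (x i) := (isOpen_lt continuous_const continuous_abs).mem_nhds hx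
        filter_upwards [this] with s hs
        exact h0 _ _ (Or.inl (le_of_lt hs))
      · exact Eventually.of_forall fun s => h0 _ _ (Or.inr hx.le)
    simp only [hG]
    rw [this.iteratedDeriv_eq]
    simp
  have hint : ∀ j, Integrable (G j) := by
    intro j
    have hmeas : Measurable (G j) := by
      have := (measurable_iteratedDeriv_left hf hm j).comp
        (f := fun x : Plane => (x i, x k)) (by fun_prop)
      exact Complex.measurable_ofReal.comp this
    obtain ⟨C, hC⟩ := hb j R
    have hsupp : Function.support (G j) ⊆ Metric.closedBall 0 (2 * R) := by
      intro x hx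
      have h1 : ¬ (R < |x i| ∨ R < |x k|) := fun h => hx (hzero j x h)
      push Not at h1
      rw [mem_closedBall_zero_iff]
      refine (Plane.norm_le x).trans ?_
      fin_cases i <;> fin_cases k <;> simp_all <;> linarith
    rw [← integrableOn_iff_integrable_of_support_subset hsupp]
    refine Measure.integrableOn_of_bounded (M := max C 0) measure_closedBall_lt_top.ne
      hmeas.aestronglyMeasurable (Eventually.of_forall fun x => ?_)
    by_cases h : R < |x i| ∨ R < |x k|
    · rw [hzero j x h, norm_zero]
      exact le_max_right _ _
    · push Not at h
      refine le_trans ?_ (le_max_left _ _)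
      simpa [hG] using hC _ _ h.1 h.2
  have hderiv : ∀ j x, HasLineDerivAt ℝ (G j) (G (j + 1) x) x (EuclideanSpace.single i (1 : ℝ)) := by
    intro j x
    unfold HasLineDerivAt
    have hd : HasDerivAt (iteratedDeriv j fun s => f s (x k))
        (iteratedDeriv (j + 1) (fun s => f s (x k)) (x i)) (x i + 0) := by
      rw [iteratedDeriv_succ, add_zero]
      exact ((hf (x k)).differentiable_iteratedDeriv j
        (by exact_mod_cast WithTop.coe_lt_top _) (x i)).hasDerivAt
    have := (hd.comp_const_add (x i) 0).ofReal_comp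
    simpa [hG, hik.symm] using this
  have hF : ∀ j w, 𝓕 (G j) w = (2 * Real.pi * Complex.I * w i : ℂ) ^ j * 𝓕 (G 0) w := by
    intro j w
    induction j with
    | zero => simp
    | succ j ih =>
      rw [fourier_lineDeriv (hint j) (hint (j + 1)) (hderiv j), ih, pow_succ']
      have : inner ℝ (EuclideanSpace.single i (1 : ℝ)) w = w i := by
        simp [EuclideanSpace.inner_single_left]
      rw [this]
      ring
  have hG0 : G 0 = fun x : Plane => (f (x i) (x k) : ℂ) := by
    ext x
    simp [hG]
  rw [← hG0]
  refine ⟨hint 0, fun j => ⟨∫ x, ‖G j x‖, fun w => ?_⟩⟩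
  have h1 : ‖𝓕 (G j) w‖ ≤ ∫ x, ‖G j x‖ := by
    rw [Real.fourier_eq]
    refine (norm_integral_le_integral_norm _).trans (le_of_eq ?_)
    simp
  refine le_trans ?_ h1
  rw [hF j w, norm_mul, norm_pow]
  refine mul_le_mul_of_nonneg_right (pow_le_pow_left₀ (abs_nonneg _) ?_ j) (norm_nonneg _)
  simp only [norm_mul, Complex.norm_real, Complex.norm_I, Real.norm_eq_abs, mul_one,
    Complex.norm_ofNat]
  rw [abs_of_pos Real.pi_pos]
  nlinarith [Real.pi_gt_three, abs_nonneg (w i)]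

/-- By the mean value inequality `f` is Lipschitz in `s`, locally uniformly in `t`; continuity in
`t` is then needed only on the line `s = s₀`. -/
theorem continuous_of_boundedDerivs {f : ℝ → ℝ → ℝ}
    (hs : ∀ t, ContDiff ℝ ∞ fun s => f s t) (ht : ∀ s, ContDiff ℝ ∞ fun t => f s t)
    (hb : BoundedDerivs f) : Continuous fun p : ℝ × ℝ => f p.1 p.2 := by
  rw [continuous_iff_continuousAt]
  rintro ⟨s₀, t₀⟩
  obtain ⟨C, hC⟩ := hb 1 (|s₀| + |t₀| + 1)
  have hlip : ∀ s t : ℝ, |s - s₀| < 1 → |t - t₀| < 1 → |f s t - f s₀ t| ≤ C * |s - s₀| := by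
    intro s t h1 h2
    have hbd : ∀ x ∈ Metric.ball s₀ 1, ‖deriv (fun s => f s t) x‖ ≤ C := by
      intro x hx
      rw [← iteratedDeriv_one]
      have hx' : |x - s₀| < 1 := hx
      refine hC x t ?_ ?_
      · have := abs_sub_abs_le_abs_sub x s₀
        have := abs_nonneg t₀
        linarith
      · have := abs_sub_abs_le_abs_sub t t₀
        have := abs_nonneg s₀
        linarith
    exact (convex_ball s₀ 1).norm_image_sub_le_of_norm_deriv_le
      (fun x _ => ((hs t).differentiable (by simp)) x) hbd
      (Metric.mem_ball_self one_pos) h1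
  rw [ContinuousAt, tendsto_iff_dist_tendsto_zero]
  have hlim : Tendsto (fun p : ℝ × ℝ => C * |p.1 - s₀| + |f s₀ p.2 - f s₀ t₀|) (𝓝 (s₀, t₀))
      (𝓝 0) := by
    have hc : Continuous fun p : ℝ × ℝ => C * |p.1 - s₀| + |f s₀ p.2 - f s₀ t₀| := by
      have := (ht s₀).continuous
      fun_prop
    simpa using hc.tendsto (s₀, t₀)
  refine squeeze_zero' (Eventually.of_forall fun _ => dist_nonneg) ?_ hlim
  filter_upwards [prod_mem_nhds (Metric.ball_mem_nhds s₀ one_pos)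
    (Metric.ball_mem_nhds t₀ one_pos)] with p hp
  rw [Real.dist_eq]
  calc |f p.1 p.2 - f s₀ t₀| ≤ |f p.1 p.2 - f s₀ p.2| + |f s₀ p.2 - f s₀ t₀| := abs_sub_le _ _ _
    _ ≤ _ := add_le_add_left (hlip _ _ hp.1 hp.2) _

/-- Rapid decay of the Fourier transform in each coordinate separately gives rapid decay in the
norm, so all its moments are integrable and Fourier inversion gives smoothness. No mixed derivatives
enter. -/
theorem contDiff_of_boundedDerivs_of_support {f : ℝ → ℝ → ℝ} {R : ℝ}
    (h0 : ∀ s t, R ≤ |s| ∨ R ≤ |t| → f s t = 0)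
    (hs : ∀ t, ContDiff ℝ ∞ fun s => f s t) (ht : ∀ s, ContDiff ℝ ∞ fun t => f s t)
    (hbs : BoundedDerivs f) (hbt : BoundedDerivs fun t s => f s t) :
    ContDiff ℝ ∞ fun p : ℝ × ℝ => f p.1 p.2 := by
  have hc := continuous_of_boundedDerivs hs ht hbs
  set F : Plane → ℂ := fun x => (f (x 0) (x 1) : ℂ) with hFdef
  obtain ⟨hint, hd0⟩ := fourier_decay_of_bounded_derivs h0 hs hc.measurable hbs
    (i := 0) (k := 1) (by decide)
  obtain ⟨-, hd1⟩ := fourier_decay_of_bounded_derivs (f := fun t s => f s t)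
    (fun s t h => h0 t s h.symm) ht (hc.measurable.comp measurable_swap) hbt
    (i := 1) (k := 0) (by decide)
  rw [← hFdef] at hint
  have hFc : Continuous F := by
    have := hc.comp (f := fun x : Plane => (x 0, x 1)) (by fun_prop)
    exact Complex.continuous_ofReal.comp this
  have hFFc : Continuous (𝓕 F) :=
    VectorFourier.fourierIntegral_continuous Real.continuous_fourierChar
      (by exact continuous_inner) hint
  have hdecay : ∀ n : ℕ, Integrable fun w : Plane => ‖w‖ ^ n * ‖𝓕 F w‖ := by
    intro n
    obtain ⟨A, hA⟩ := hd0 (n + 3)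
    obtain ⟨B, hB⟩ := hd1 (n + 3)
    obtain ⟨D, hD⟩ := hd0 0
    -- The exponent `3` exceeds the dimension `2`; this is the reason for decay of order `n + 3`.
    have hI : Integrable fun w : Plane => (3 ^ (n + 3) * (D + A + B)) * (1 + ‖w‖) ^ (-(3 : ℝ)) :=
      (integrable_one_add_norm (by simp; norm_num)).const_mul _
    refine hI.mono' (by fun_prop) (Eventually.of_forall fun w => ?_)
    have hpos : 0 < 1 + ‖w‖ := by positivity
    rw [Real.norm_of_nonneg (by positivity), Real.rpow_neg hpos.le, ← div_eq_mul_inv,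
      le_div_iff₀ (by positivity)]
    have h3 : (1 + ‖w‖) ^ (3 : ℝ) = (1 + ‖w‖) ^ 3 := by
      exact_mod_cast Real.rpow_natCast (1 + ‖w‖) 3
    rw [h3]
    have hle : (1 + ‖w‖) ^ (n + 3) ≤ 3 ^ (n + 3) * (1 + |w 0| ^ (n + 3) + |w 1| ^ (n + 3)) := by
      have hw := Plane.norm_le w
      have a0 := abs_nonneg (w 0)
      have a1 := abs_nonneg (w 1)
      have hmax : 1 + ‖w‖ ≤ 3 * max 1 (max |w 0| |w 1|) := by
        have := le_max_left 1 (max |w 0| |w 1|)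
        have := (le_max_left |w 0| |w 1|).trans (le_max_right 1 _)
        have := (le_max_right |w 0| |w 1|).trans (le_max_right 1 _)
        linarith
      refine (pow_le_pow_left₀ hpos.le hmax _).trans ?_
      rw [mul_pow]
      refine mul_le_mul_of_nonneg_left ?_ (by positivity)
      have p0 := pow_nonneg a0 (n + 3)
      have p1 := pow_nonneg a1 (n + 3)
      rcases max_choice 1 (max |w 0| |w 1|) with h | h
      · rw [h, one_pow]
        linarith
      · rw [h]
        rcases max_choice |w 0| |w 1| with h | h <;> rw [h] <;> linarith
    calc ‖w‖ ^ n * ‖𝓕 F w‖ * (1 + ‖w‖) ^ 3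
        ≤ (1 + ‖w‖) ^ n * ‖𝓕 F w‖ * (1 + ‖w‖) ^ 3 := by gcongr; linarith
      _ = (1 + ‖w‖) ^ (n + 3) * ‖𝓕 F w‖ := by ring
      _ ≤ 3 ^ (n + 3) * (1 + |w 0| ^ (n + 3) + |w 1| ^ (n + 3)) * ‖𝓕 F w‖ := by gcongr
      _ = 3 ^ (n + 3) * (|w 0| ^ 0 * ‖𝓕 F w‖ + |w 0| ^ (n + 3) * ‖𝓕 F w‖ +
            |w 1| ^ (n + 3) * ‖𝓕 F w‖) := by ring
      _ ≤ 3 ^ (n + 3) * (D + A + B) :=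
          mul_le_mul_of_nonneg_left (add_le_add (add_le_add (hD w) (hA w)) (hB w)) (by positivity)
  have hFF : Integrable (𝓕 F) := by
    have := hdecay 0
    simp only [pow_zero, one_mul] at this
    exact (integrable_norm_iff hFFc.aestronglyMeasurable).1 this
  have hsmooth : ContDiff ℝ ∞ (𝓕 (𝓕 F)) := Real.contDiff_fourier (N := ⊤) fun n _ => hdecay n
  have hF : ContDiff ℝ ∞ F := by
    rw [← hFc.fourierInv_fourier_eq hint hFF]
    have : 𝓕⁻ (𝓕 F) = fun w => 𝓕 (𝓕 F) (-w) := by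
      ext w
      exact Real.fourierInv_eq_fourier_neg _ _
    rw [this]
    exact hsmooth.comp contDiff_neg
  have hplane : ContDiff ℝ ∞ fun p : ℝ × ℝ => (!₂[p.1, p.2] : Plane) := by
    rw [contDiff_euclidean]
    intro i
    fin_cases i
    · exact contDiff_fst
    · exact contDiff_snd
  have := Complex.reCLM.contDiff.comp (hF.comp hplane)
  simpa [hFdef, Function.comp_def] using this

/-- Smoothness is local, so `f` may be multiplied by cutoffs in both variables; `aux` is the Leibniz
estimate showing that this preserves the bounds. -/
theorem contDiff_of_boundedDerivs {f : ℝ → ℝ → ℝ}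
    (hs : ∀ t, ContDiff ℝ ∞ fun s => f s t) (ht : ∀ s, ContDiff ℝ ∞ fun t => f s t)
    (hbs : BoundedDerivs f) (hbt : BoundedDerivs fun t s => f s t) :
    ContDiff ℝ ∞ fun p : ℝ × ℝ => f p.1 p.2 := by
  have aux : ∀ (β : ContDiffBump (0 : ℝ)) (f : ℝ → ℝ → ℝ), (∀ t, ContDiff ℝ ∞ fun s => f s t) →
      BoundedDerivs f → BoundedDerivs fun s t => β s * (β t * f s t) := by
    intro β f hs hb j R
    obtain ⟨M, hM0, hM⟩ := exists_bound_iteratedFDeriv β.contDiff β.hasCompactSupport j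
    choose C hC using fun i => hb i R
    refine ⟨∑ i ∈ Finset.range (j + 1), (j.choose i) * M * |C (j - i)|, fun s t h1 h2 => ?_⟩
    have hβ : ContDiff ℝ ∞ β := β.contDiff
    have e : (fun s => β s * (β t * f s t)) = fun s => β t * (β s * f s t) := by
      ext s
      ring
    have hsm : ContDiff ℝ j fun s => β s * f s t :=
      (hβ.mul (hs t)).of_le (by exact_mod_cast le_top)
    rw [e, iteratedDeriv_const_mul_field]
    rw [abs_mul, abs_of_nonneg β.nonneg]
    refine (mul_le_of_le_one_left (abs_nonneg _) β.le_one).trans ?_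
    rw [← Real.norm_eq_abs, ← norm_iteratedFDeriv_eq_norm_iteratedDeriv]
    refine (norm_iteratedFDeriv_mul_le hβ (hs t) s (by exact_mod_cast le_top)).trans ?_
    refine Finset.sum_le_sum fun i hi => ?_
    have hi' : i ≤ j := by
      have := Finset.mem_range.1 hi
      omega
    refine mul_le_mul (mul_le_mul_of_nonneg_left (hM i hi' s) (by positivity)) ?_
      (norm_nonneg _) (by positivity)
    rw [norm_iteratedFDeriv_eq_norm_iteratedDeriv, Real.norm_eq_abs]
    exact (hC _ s t h1 h2).trans (le_abs_self _)
  rw [contDiff_iff_contDiffAt]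
  rintro ⟨s₀, t₀⟩
  let β : ContDiffBump (0 : ℝ) := ⟨|s₀| + |t₀| + 1, |s₀| + |t₀| + 2, by positivity, by linarith⟩
  have hβ : ContDiff ℝ ∞ β := β.contDiff
  have hmain := contDiff_of_boundedDerivs_of_support (R := |s₀| + |t₀| + 2)
    (f := fun s t => β s * (β t * f s t))
    (fun s t h => by
      rcases h with h | h
      · rw [β.zero_of_le_dist (by simpa [β] using h), zero_mul]
      · rw [β.zero_of_le_dist (x := t) (by simpa [β] using h), zero_mul, mul_zero])
    (fun t => hβ.mul (contDiff_const.mul (hs t)))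
    (fun s => contDiff_const.mul (hβ.mul (ht s)))
    (aux β f hs hbs)
    (by
      have := aux β (fun t s => f s t) ht hbt
      have e : (fun t s => β s * (β t * f s t)) = fun t s => β t * (β s * f s t) := by
        ext t s
        ring
      rw [e]
      exact this)
  refine hmain.contDiffAt.congr_of_eventuallyEq ?_
  have h1 : |s₀| < |s₀| + |t₀| + 1 := by linarith [abs_nonneg t₀]
  have h2 : |t₀| < |s₀| + |t₀| + 1 := by linarith [abs_nonneg s₀]
  filter_upwards [prod_mem_nhds ((isOpen_lt continuous_abs continuous_const).mem_nhds h1)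
    ((isOpen_lt continuous_abs continuous_const).mem_nhds h2)] with p hp
  have hp1 : |p.1| < |s₀| + |t₀| + 1 := hp.1
  have hp2 : |p.2| < |s₀| + |t₀| + 1 := hp.2
  rw [β.one_of_mem_closedBall (by simpa [β] using hp1.le),
    β.one_of_mem_closedBall (by simpa [β] using hp2.le), one_mul, one_mul]

/-- Boman's theorem in the plane. -/
theorem ArcSmooth.contDiff {f : ℝ → ℝ → ℝ} (hf : ArcSmooth f) :
    ContDiff ℝ ∞ fun p : ℝ × ℝ => f p.1 p.2 :=
  contDiff_of_boundedDerivs hf.contDiff_left hf.swap.contDiff_left hf.boundedDerivs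
    hf.swap.boundedDerivs

/-! ### Weakly smooth curves in `C([-R, R])` and cartesian closedness. -/

/-- The restriction of a continuous function to the interval `[-R, R]`. -/
def restrictInterval (R : ℝ) (g : ℝ → ℝ) (hg : Continuous g) : C(Set.Icc (-R) R, ℝ) :=
  ⟨fun t => g t, hg.comp continuous_subtype_val⟩

theorem contDiff_deriv_left {e : ℝ → ℝ → ℝ} (he : ContDiff ℝ ∞ fun p : ℝ × ℝ => e p.1 p.2) :
    ContDiff ℝ ∞ fun p : ℝ × ℝ => deriv (fun s => e s p.2) p.1 := by
  have h : (fun p : ℝ × ℝ => deriv (fun s => e s p.2) p.1) = fun p =>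
      fderiv ℝ (fun p : ℝ × ℝ => e p.1 p.2) p (1, 0) := by
    ext ⟨s, t⟩
    have h1 : HasDerivAt (fun s : ℝ => (s, t)) (1, 0) s :=
      (hasDerivAt_id s).prodMk (hasDerivAt_const s t)
    exact (((he.differentiable (by simp)) (s, t)).hasFDerivAt.comp_hasDerivAt s h1).deriv
  rw [h]
  exact (he.fderiv_right (m := ∞) (by simp)).clm_apply contDiff_const

theorem contDiff_iteratedDeriv_right {e : ℝ → ℝ → ℝ}
    (he : ContDiff ℝ ∞ fun p : ℝ × ℝ => e p.1 p.2) (k : ℕ) :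
    ContDiff ℝ ∞ fun p : ℝ × ℝ => iteratedDeriv k (e p.1) p.2 := by
  induction k with
  | zero => simpa using he
  | succ k ih =>
    have h1 : ContDiff ℝ ∞ fun p : ℝ × ℝ => iteratedDeriv k (e p.2) p.1 :=
      ih.comp (contDiff_snd.prodMk contDiff_fst)
    have h2 := contDiff_deriv_left (e := fun t s => iteratedDeriv k (e s) t) h1
    simp only [iteratedDeriv_succ]
    exact h2.comp (contDiff_snd.prodMk contDiff_fst)

/-- Joint continuity of the partial derivative makes it, by currying over the compact interval, a
continuous curve in the sup norm. The curve is its integral, as evaluation at points shows. -/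
theorem hasDerivAt_restrictInterval (R : ℝ) {e : ℝ → ℝ → ℝ}
    (he : ContDiff ℝ ∞ fun p : ℝ × ℝ => e p.1 p.2) (s : ℝ) :
    HasDerivAt (fun s => restrictInterval R (e s)
        (he.continuous.comp (continuous_const.prodMk continuous_id)))
      (restrictInterval R (fun t => deriv (fun s => e s t) s)
        ((contDiff_deriv_left he).continuous.comp (continuous_const.prodMk continuous_id))) s := by
  have hE := contDiff_deriv_left he
  set D : ℝ → C(Set.Icc (-R) R, ℝ) := fun s => restrictInterval R
    (fun t => deriv (fun s => e s t) s) (hE.continuous.comp (continuous_const.prodMk continuous_id))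
    with hD
  have hDc : Continuous D := by
    let g : C(ℝ × Set.Icc (-R) R, ℝ) := ⟨fun p => deriv (fun s => e s p.2) p.1,
      hE.continuous.comp (continuous_fst.prodMk (continuous_subtype_val.comp continuous_snd))⟩
    exact g.curry.continuous
  have heq : (fun s => restrictInterval R (e s)
      (he.continuous.comp (continuous_const.prodMk continuous_id))) = fun s =>
      restrictInterval R (e 0)
        (he.continuous.comp (continuous_const.prodMk continuous_id)) + ∫ r in (0 : ℝ)..s, D r := by
    ext s t
    have h1 := (ContinuousMap.evalCLM ℝ t).intervalIntegral_comp_comm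
      (hDc.intervalIntegrable (μ := volume) 0 s)
    rw [ContinuousMap.add_apply]
    change e s t = e 0 t + ContinuousMap.evalCLM ℝ t (∫ r in (0 : ℝ)..s, D r)
    rw [← h1]
    have h2 : ContDiff ℝ ∞ fun s => e s t := he.comp (contDiff_id.prodMk contDiff_const)
    have h3 : ∫ r in (0 : ℝ)..s, deriv (fun s => e s t) r = e s t - e 0 t :=
      intervalIntegral.integral_deriv_eq_sub
        (fun x _ => (h2.differentiable (by simp)) x)
        ((h2.continuous_deriv (by simp)).intervalIntegrable _ _)
    change e s t = e 0 t + ∫ r in (0 : ℝ)..s, deriv (fun s => e s t) r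
    rw [h3]
    ring
  rw [heq]
  exact (hDc.integral_hasStrictDerivAt 0 s).hasDerivAt.const_add _

theorem contDiff_restrictInterval (R : ℝ) {e : ℝ → ℝ → ℝ}
    (he : ContDiff ℝ ∞ fun p : ℝ × ℝ => e p.1 p.2) :
    ContDiff ℝ ∞ fun s => restrictInterval R (e s)
        (he.continuous.comp (continuous_const.prodMk continuous_id)) := by
  rw [contDiff_infty]
  intro n
  induction n generalizing e with
  | zero =>
    refine contDiff_zero.2 (continuous_iff_continuousAt.2 fun s =>
      (hasDerivAt_restrictInterval R he s).continuousAt)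
  | succ n ih =>
    push_cast
    refine contDiff_succ_iff_deriv.2
      ⟨fun s => (hasDerivAt_restrictInterval R he s).differentiableAt, by simp, ?_⟩
    have : deriv (fun s => restrictInterval R (e s)
        (he.continuous.comp (continuous_const.prodMk continuous_id))) = _ :=
      funext fun s => (hasDerivAt_restrictInterval R he s).deriv
    rw [this]
    exact ih (contDiff_deriv_left he)

/-- A curve in a normed space which is smooth against all functionals has bounded derivatives,
uniformly with respect to the functionals. -/
theorem exists_bound_iteratedDeriv_of_weakly_smooth {E : Type*} [NormedAddCommGroup E]
    [NormedSpace ℝ E] {c : ℝ → E} (hc : ∀ l : StrongDual ℝ E, ContDiff ℝ ∞ fun s => l (c s))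
    (j : ℕ) (R : ℝ) :
    ∃ C, ∀ s : ℝ, |s| ≤ R → ∀ l : StrongDual ℝ E,
      |iteratedDeriv j (fun s => l (c s)) s| ≤ C * ‖l‖ := by
  have key : ∃ T : ℝ → (StrongDual ℝ E →L[ℝ] ℝ), ∀ s l,
      T s l = iteratedDeriv j (fun s => l (c s)) s := by
    induction j with
    | zero => exact ⟨fun s => NormedSpace.inclusionInDoubleDual ℝ E (c s), fun s l => by simp⟩
    | succ j ih =>
      obtain ⟨T, hT⟩ := ih
      have hlim : ∀ s, Tendsto (fun (n : ℕ) (l : StrongDual ℝ E) =>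
          ((1 / ((n : ℝ) + 1))⁻¹ • (T (s + 1 / ((n : ℝ) + 1)) - T s)) l) atTop
          (𝓝 fun l => iteratedDeriv (j + 1) (fun s => l (c s)) s) := by
        intro s
        rw [tendsto_pi_nhds]
        intro l
        have hd : HasDerivAt (iteratedDeriv j fun s => l (c s))
            (iteratedDeriv (j + 1) (fun s => l (c s)) s) s := by
          rw [iteratedDeriv_succ]
          exact ((hc l).differentiable_iteratedDeriv j
            (by exact_mod_cast WithTop.coe_lt_top _) s).hasDerivAt
        have h := hd.tendsto_slope_zero_right.comp
          (tendsto_nhdsWithin_iff.2 ⟨tendsto_one_div_add_atTop_nhds_zero_nat,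
            Eventually.of_forall fun n => by
              change (0 : ℝ) < 1 / ((n : ℝ) + 1)
              positivity⟩)
        refine h.congr fun n => ?_
        simp [hT]
      -- A pointwise limit of bounded operators is bounded because the dual is complete; `E` itself
      -- need not be.
      exact ⟨fun s => continuousLinearMapOfTendsto _ (hlim s), fun s l => rfl⟩
  obtain ⟨T, hT⟩ := key
  have hbs : ∃ C, ∀ s : Metric.closedBall (0 : ℝ) R, ‖T s‖ ≤ C := by
    refine banach_steinhaus fun l => ?_
    obtain ⟨C, hC⟩ := (isCompact_closedBall (0 : ℝ) R).exists_bound_of_continuousOn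
      ((hc l).continuous_iteratedDeriv j (by exact_mod_cast le_top)).continuousOn
    exact ⟨C, fun s => by rw [hT]; exact hC s s.2⟩
  obtain ⟨C, hC⟩ := hbs
  refine ⟨C, fun s hs l => ?_⟩
  rw [← hT, ← Real.norm_eq_abs]
  exact (T s).le_of_opNorm_le (hC ⟨s, by simpa using hs⟩) l

theorem norm_evalCLM_le {K : Type*} [TopologicalSpace K] [CompactSpace K] (t : K) :
    ‖(ContinuousMap.evalCLM ℝ t : C(K, ℝ) →L[ℝ] ℝ)‖ ≤ 1 :=
  ContinuousLinearMap.opNorm_le_bound _ zero_le_one fun g => by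
    rw [one_mul]
    exact g.norm_coe_le_norm t

/-- Point evaluations have norm at most `1`, so bounds uniform in the functionals become bounds
uniform in `t`. Only the cases `k = 0` and `j = 0` of `hbd` are used. -/
theorem contDiff_of_weakly_smooth {f : ℝ → ℝ → ℝ} (ht : ∀ s, ContDiff ℝ ∞ (f s))
    (hw : ∀ (R : ℝ) (k : ℕ) (l : StrongDual ℝ C(Set.Icc (-R) R, ℝ)), ContDiff ℝ ∞ fun s =>
      l (restrictInterval R (iteratedDeriv k (f s))
        ((ht s).continuous_iteratedDeriv k (by exact_mod_cast le_top)))) :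
    ContDiff ℝ ∞ fun p : ℝ × ℝ => f p.1 p.2 := by
  have hbd : ∀ (j k : ℕ) (R : ℝ), ∃ C, ∀ s t : ℝ, |s| ≤ R → |t| ≤ R →
      |iteratedDeriv j (fun s => iteratedDeriv k (f s) t) s| ≤ C := by
    intro j k R
    obtain ⟨C, hC⟩ := exists_bound_iteratedDeriv_of_weakly_smooth (hw R k) j R
    refine ⟨|C|, fun s t hs ht' => ?_⟩
    let t' : Set.Icc (-R) R := ⟨t, abs_le.1 ht'⟩
    have h := hC s hs (ContinuousMap.evalCLM ℝ t')
    refine h.trans ((mul_le_mul_of_nonneg_right (le_abs_self C) (norm_nonneg _)).trans ?_)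
    exact mul_le_of_le_one_right (abs_nonneg _) (norm_evalCLM_le _)
  refine contDiff_of_boundedDerivs (fun t => ?_) ht (fun j R => ?_) (fun k R => ?_)
  · let t' : Set.Icc (-|t|) |t| := ⟨t, neg_abs_le t, le_abs_self t⟩
    have := hw |t| 0 (ContinuousMap.evalCLM ℝ t')
    simpa [restrictInterval] using this
  · simpa using hbd j 0 R
  · obtain ⟨C, hC⟩ := hbd 0 k R
    exact ⟨C, fun s t h1 h2 => by simpa using hC t s h2 h1⟩

namespace FrolicherSpace

theorem contDiff_comp_apply {X Y : FrolicherSpace.{u}} {χ : X → ℝ} (hχ : χ ∈ X.functions)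
    {b : ℝ → Y} (hb : b ∈ Y.curves) (h : SmoothMap Y X) : ContDiff ℝ ∞ fun t => χ (h.1 (b t)) :=
  (X.mem_curves _).1 (h.2 b hb) χ hχ

/-- Cartesian closedness: the curves which define the structure of `X ^ Y` are all its curves. -/
theorem mem_curves_exponential {X Y : FrolicherSpace.{u}} (c : ℝ → SmoothMap Y X) :
    c ∈ (exponential X Y).curves ↔ ∀ σ : ℝ → ℝ, ContDiff ℝ ∞ σ → ∀ b ∈ Y.curves,
      (fun s : ℝ => (c (σ s)).1 (b s)) ∈ X.curves := by
  refine ⟨fun hc σ hσ b hb => (X.mem_curves _).2 fun χ hχ => ?_, fun hc f hf => hf c hc⟩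
  have ht : ∀ h : SmoothMap Y X, ContDiff ℝ ∞ fun t => χ (h.1 (b t)) :=
    contDiff_comp_apply hχ hb
  have key : ContDiff ℝ ∞ fun p : ℝ × ℝ => χ ((c p.1).1 (b p.2)) := by
    refine contDiff_of_weakly_smooth (f := fun s t => χ ((c s).1 (b t))) (fun s => ht (c s))
      fun R k l => ?_
    -- A curve of the generated structure may be tested on any functional that is smooth along the
    -- generating curves `d`.
    refine hc (fun h => l (restrictInterval R (iteratedDeriv k fun t => χ (h.1 (b t)))
      ((ht h).continuous_iteratedDeriv k (by exact_mod_cast le_top)))) fun d hd => ?_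
    have hd' : ContDiff ℝ ∞ fun p : ℝ × ℝ => χ ((d p.1).1 (b p.2)) := by
      refine ArcSmooth.contDiff (f := fun s t => χ ((d s).1 (b t))) fun σ τ hσ hτ => ?_
      refine (X.mem_curves _).1 (hd σ hσ (b ∘ τ) ((Y.mem_curves _).2 fun g hg => ?_)) χ hχ
      exact ((Y.mem_curves _).1 hb g hg).comp hτ
    exact l.contDiff.comp (contDiff_restrictInterval R
      (contDiff_iteratedDeriv_right (e := fun s t => χ ((d s).1 (b t))) hd' k))
  exact key.comp (hσ.prodMk contDiff_id)

end FrolicherSpace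

/-! ### Hadamard's lemma and Weil algebras. -/

/-- The integral is the value at `0` of the convolution of the indicator of `(0, 1]` with `r ↦ β r *
g (x, -r)`. The cutoff `β` is `1` on `[-1, 1]` and supplies the compact support. -/
theorem contDiff_parametric_integral {E : Type*} [NormedAddCommGroup E] [NormedSpace ℝ E]
    {g : E × ℝ → ℝ} (hg : ContDiff ℝ ∞ g) :
    ContDiff ℝ ∞ fun x => ∫ r in (0 : ℝ)..1, g (x, r) := by
  let β : ContDiffBump (0 : ℝ) := ⟨1, 2, one_pos, one_lt_two⟩
  have hβ : ContDiff ℝ ∞ β := β.contDiff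
  have h := contDiffOn_convolution_right_with_param_comp (𝕜 := ℝ) (n := ⊤) (μ := volume)
    (ContinuousLinearMap.mul ℝ ℝ) (s := Set.univ) (v := fun _ : E => (0 : ℝ)) contDiffOn_const
    (f := Set.indicator (Set.Ioc (0 : ℝ) 1) fun _ => 1) (g := fun x r => β r * g (x, -r))
    (k := Metric.closedBall 0 2) isOpen_univ (isCompact_closedBall _ _)
    (fun x r _ hr => by
      rw [β.zero_of_le_dist (by simpa [β] using (not_le.1 fun h => hr (by simpa using h)).le),
        zero_mul])
    ((integrable_indicator_iff measurableSet_Ioc).2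
      (integrableOn_const (by simp))).locallyIntegrable
    (((hβ.comp contDiff_snd).mul
      (hg.comp (contDiff_fst.prodMk contDiff_snd.neg))).contDiffOn)
  rw [contDiffOn_univ] at h
  convert h using 1
  ext x
  rw [convolution_def, intervalIntegral.integral_of_le zero_le_one,
    ← integral_indicator measurableSet_Ioc]
  refine integral_congr_ae (Eventually.of_forall fun r => ?_)
  by_cases hr : r ∈ Set.Ioc (0 : ℝ) 1
  · have : β (-r) = 1 := β.one_of_mem_closedBall (by
      simpa [β, abs_of_pos hr.1] using hr.2)
    simp [hr, this]
  · simp [hr]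

/-- A quotient of a real algebra with an augmentation whose kernel is generated by finitely many
elements which become nilpotent in the quotient. -/
theorem finite_and_isLocalRing_quotient {S : Type*} [CommRing S] [Algebra ℝ S] (I : Ideal S)
    (φ : S →ₐ[ℝ] ℝ) {ι : Type*} [Finite ι] (x : ι → S)
    (hx : ∀ a, φ a = 0 → a ∈ Ideal.span (Set.range x)) (hI : ∀ a ∈ I, φ a = 0)
    (hφ : ∀ i, φ (x i) = 0) (hn : ∀ i, ∃ N : ℕ, x i ^ N ∈ I) :
    Module.Finite ℝ (S ⧸ I) ∧ IsLocalRing (S ⧸ I) := by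
  let ψ : S ⧸ I →ₐ[ℝ] ℝ := Ideal.Quotient.liftₐ I φ hI
  have hker : RingHom.ker ψ = Ideal.span (Set.range fun i => Ideal.Quotient.mk I (x i)) := by
    refine le_antisymm (fun a ha => ?_) (Ideal.span_le.2 ?_)
    · obtain ⟨f, rfl⟩ := Ideal.Quotient.mk_surjective a
      have := Ideal.mem_map_of_mem (Ideal.Quotient.mk I) (hx f ha)
      rwa [Ideal.map_span, ← Set.range_comp] at this
    · rintro _ ⟨i, rfl⟩
      exact hφ i
  have hnil : RingHom.ker ψ ≤ nilradical (S ⧸ I) := by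
    rw [hker, Ideal.span_le]
    rintro _ ⟨i, rfl⟩
    obtain ⟨N, hN⟩ := hn i
    have h : IsNilpotent (Ideal.Quotient.mk I (x i)) :=
      ⟨N, by rw [← map_pow, Ideal.Quotient.eq_zero_iff_mem.2 hN]⟩
    exact h
  constructor
  · refine Module.finite_of_surjective_of_ker_le_nilradical ψ
      (fun r => ⟨algebraMap ℝ _ r, ψ.commutes r⟩) hnil ?_
    rw [hker]
    exact Submodule.fg_span (Set.finite_range _)
  -- Each `a` differs from the scalar `ψ a` by a nilpotent, so `ψ` reflects units.
  · have : IsLocalHom (ψ : S ⧸ I →+* ℝ) := ⟨fun a ha => by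
      have h : IsNilpotent (a - algebraMap ℝ _ (ψ a)) := by
        refine hnil ?_
        rw [RingHom.mem_ker, map_sub, AlgHom.commutes]
        exact sub_self _
      have hu : IsUnit (algebraMap ℝ (S ⧸ I) (ψ a)) := ha.map _
      have := h.isUnit_add_left_of_commute hu (Commute.all _ _)
      simpa using this⟩
    exact RingHom.domain_isLocalRing (ψ : S ⧸ I →+* ℝ)

/-- A finite-dimensional algebra is Artinian, so its nilradical is the maximal ideal when it is
local. -/
theorem exists_pow_mem_of_finite_quotient {S : Type*} [CommRing S] [Algebra ℝ S] (I : Ideal S)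
    (φ : S →ₐ[ℝ] ℝ) (hI : ∀ a ∈ I, φ a = 0) (hfin : Module.Finite ℝ (S ⧸ I))
    (hloc : IsLocalRing (S ⧸ I)) {a : S} (ha : φ a = 0) : ∃ N : ℕ, a ^ N ∈ I := by
  have : IsArtinianRing (S ⧸ I) := IsArtinianRing.of_finite ℝ (S ⧸ I)
  have h : IsNilpotent (Ideal.Quotient.mk I a) := by
    rw [← mem_nilradical, Ring.KrullDimLE.nilradical_eq_maximalIdeal,
      IsLocalRing.mem_maximalIdeal]
    intro hu
    have := hu.map (Ideal.Quotient.liftₐ I φ hI)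
    exact not_isUnit_zero (ha ▸ this : IsUnit (0 : ℝ))
  obtain ⟨N, hN⟩ := h
  exact ⟨N, Ideal.Quotient.eq_zero_iff_mem.1 (by rw [map_pow, hN])⟩

/-- The coordinate functions on `ℝⁿ`. -/
def smoothFunctions.coord {n : ℕ} (i : Fin n) : smoothFunctions n :=
  ⟨fun x => x i, (contDiff_apply ℝ ℝ i : ContDiff ℝ ∞ fun x : Fin n → ℝ => x i)⟩

/-- Hadamard's lemma. -/
theorem vanishingAtZero_eq_span (n : ℕ) :
    vanishingAtZero n = Ideal.span (Set.range (smoothFunctions.coord (n := n))) := by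
  refine le_antisymm (fun f hf => ?_) (Ideal.span_le.2 ?_)
  · have hf0 : f.1 0 = 0 := hf
    have hfs : ContDiff ℝ ∞ f.1 := f.2
    have hG : ∀ i : Fin n, ContDiff ℝ ∞ fun p : (Fin n → ℝ) × ℝ =>
        fderiv ℝ f.1 (p.2 • p.1) (Pi.single i 1) := fun i =>
      ((hfs.fderiv_right (m := ∞) (by simp)).comp (contDiff_snd.smul contDiff_fst)).clm_apply
        contDiff_const
    let g : Fin n → smoothFunctions n := fun i =>
      ⟨fun x => ∫ r in (0 : ℝ)..1, fderiv ℝ f.1 (r • x) (Pi.single i 1),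
        contDiff_parametric_integral (hG i)⟩
    have hfg : f = ∑ i, g i * smoothFunctions.coord i := by
      apply Subtype.ext
      ext x
      have hcoe : (∑ i, g i * smoothFunctions.coord i : smoothFunctions n).1 x =
          ∑ i, (∫ r in (0 : ℝ)..1, fderiv ℝ f.1 (r • x) (Pi.single i 1)) * x i := by
        rw [AddSubmonoidClass.coe_finsetSum, Finset.sum_apply]
        rfl
      rw [hcoe]
      have hc : ∀ i : Fin n, Continuous fun r : ℝ => fderiv ℝ f.1 (r • x) (Pi.single i 1) :=
        fun i => (hG i).continuous.comp (f := fun r : ℝ => (x, r)) (by fun_prop)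
      simp_rw [← intervalIntegral.integral_mul_const]
      have hsw := intervalIntegral.integral_finsetSum (μ := volume) (a := 0) (b := 1)
        (s := Finset.univ) (f := fun i r => fderiv ℝ f.1 (r • x) (Pi.single i 1) * x i)
        fun i _ => ((hc i).mul continuous_const).intervalIntegrable _ _
      rw [← hsw]
      have hsum : ∀ r : ℝ, ∑ i, fderiv ℝ f.1 (r • x) (Pi.single i 1) * x i =
          fderiv ℝ f.1 (r • x) x := by
        intro r
        have hx := congrArg (fderiv ℝ f.1 (r • x)) (Finset.univ_sum_single x)
        rw [← hx, map_sum]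
        refine Finset.sum_congr rfl fun i _ => ?_
        have : Pi.single i (x i) = x i • (Pi.single i 1 : Fin n → ℝ) := by
          rw [← Pi.single_smul, smul_eq_mul, mul_one]
        rw [this, map_smul, smul_eq_mul, mul_comm]
      simp_rw [hsum]
      have hd : ∀ r ∈ Set.uIcc (0 : ℝ) 1,
          HasDerivAt (fun r : ℝ => f.1 (r • x)) (fderiv ℝ f.1 (r • x) x) r := by
        intro r _
        have h1 : HasDerivAt (fun r : ℝ => r • x) x r := by
          simpa using (hasDerivAt_id r).smul_const x
        exact ((hfs.differentiable (by simp)) (r • x)).hasFDerivAt.comp_hasDerivAt r h1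
      rw [intervalIntegral.integral_eq_sub_of_hasDerivAt hd]
      · simp [hf0]
      · have : Continuous fun r : ℝ => fderiv ℝ f.1 (r • x) x := by
          simp_rw [← hsum]
          exact continuous_finsetSum _ fun i _ => (hc i).mul continuous_const
        exact this.intervalIntegrable _ _
    rw [hfg]
    exact Ideal.sum_mem _ fun i _ =>
      Ideal.mul_mem_left _ _ (Ideal.subset_span (Set.mem_range_self i))
  · rintro _ ⟨i, rfl⟩
    rfl

/-- Evaluation at the origin. -/
def smoothFunctions.evalZero (n : ℕ) : smoothFunctions n →ₐ[ℝ] ℝ where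
  toFun f := f.1 0
  map_one' := rfl
  map_mul' _ _ := rfl
  map_zero' := rfl
  map_add' _ _ := rfl
  commutes' _ := rfl

namespace SmoothQuotient

/-- By Hadamard's lemma the coordinates generate the augmentation ideal, so nilpotency of finitely
many elements decides the matter. -/
theorem isWeil_of_coord_pow_mem {W : SmoothQuotient} (h : W.ideal ≤ vanishingAtZero W.dim)
    (hn : ∀ i : Fin W.dim, ∃ N : ℕ, smoothFunctions.coord i ^ N ∈ W.ideal) : W.IsWeil := by
  have := finite_and_isLocalRing_quotient W.ideal (smoothFunctions.evalZero W.dim)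
    smoothFunctions.coord (fun a ha => vanishingAtZero_eq_span W.dim ▸ ha) (fun a ha => h ha)
    (fun i => rfl) hn
  exact ⟨this.1, this.2, h⟩

theorem IsWeil.exists_coord_pow_mem {W : SmoothQuotient} (hW : W.IsWeil) (i : Fin W.dim) :
    ∃ N : ℕ, smoothFunctions.coord i ^ N ∈ W.ideal :=
  exists_pow_mem_of_finite_quotient W.ideal (smoothFunctions.evalZero W.dim)
    (fun _ ha => hW.2.2 ha) hW.1 hW.2.1 rfl

/-- Each coordinate of the product is pulled back from one factor, where it is nilpotent. -/
theorem IsWeil.tensor {V W : SmoothQuotient} (hV : V.IsWeil) (hW : W.IsWeil) :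
    (V.tensor W).IsWeil := by
  refine isWeil_of_coord_pow_mem (sup_le (Ideal.map_le_iff_le_comap.2 fun f hf => hV.2.2 hf)
    (Ideal.map_le_iff_le_comap.2 fun f hf => hW.2.2 hf)) fun i => ?_
  refine Fin.addCases (fun j => ?_) (fun j => ?_) i
  · obtain ⟨N, hN⟩ := hV.exists_coord_pow_mem j
    have := Ideal.mem_map_of_mem (smoothFunctions.pullback (Fin.castAdd W.dim)) hN
    rw [map_pow] at this
    exact ⟨N, Ideal.mem_sup_left this⟩
  · obtain ⟨N, hN⟩ := hW.exists_coord_pow_mem j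
    have := Ideal.mem_map_of_mem (smoothFunctions.pullback (Fin.natAdd V.dim)) hN
    rw [map_pow] at this
    exact ⟨N, Ideal.mem_sup_right this⟩

/-- The Weil algebra `ℝ = C^∞(ℝ⁰)`. -/
def real : SmoothQuotient := ⟨0, ⊥⟩

theorem isWeil_real : real.IsWeil := isWeil_of_coord_pow_mem bot_le fun i => i.elim0

end SmoothQuotient

namespace FrolicherSpace

/-! ### Functoriality of exponentials and prolongations. -/

theorem IsSmooth.comp {X : FrolicherSpace.{u}} {Y : FrolicherSpace.{v}} {Z : FrolicherSpace.{w}}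
    {g : Y → Z} {f : X → Y} (hg : IsSmooth g) (hf : IsSmooth f) : IsSmooth (g ∘ f) :=
  fun c hc => hg _ (hf c hc)

theorem IsSmooth.comp_mem_functions {X : FrolicherSpace.{u}} {Y : FrolicherSpace.{v}} {f : X → Y}
    (hf : IsSmooth f) {χ : Y → ℝ} (hχ : χ ∈ Y.functions) : χ ∘ f ∈ X.functions :=
  (X.mem_functions _).2 fun c hc => (Y.mem_curves _).1 (hf c hc) χ hχ

theorem const_mem_curves (X : FrolicherSpace.{u}) (x : X) : (fun _ => x) ∈ X.curves :=
  (X.mem_curves _).2 fun _ _ => contDiff_const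

theorem comp_mem_curves {X : FrolicherSpace.{u}} {c : ℝ → X} (hc : c ∈ X.curves) {σ : ℝ → ℝ}
    (hσ : ContDiff ℝ ∞ σ) : (fun s => c (σ s)) ∈ X.curves :=
  (X.mem_curves _).2 fun χ hχ => ((X.mem_curves _).1 hc χ hχ).comp hσ

/-- Isomorphisms of Frölicher spaces. -/
structure Iso (X : FrolicherSpace.{u}) (Y : FrolicherSpace.{v}) where
  toEquiv : X ≃ Y
  smooth : IsSmooth toEquiv
  smooth_symm : IsSmooth toEquiv.symm

namespace Iso

variable {X : FrolicherSpace.{u}} {Y : FrolicherSpace.{v}} {Z : FrolicherSpace.{w}}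

def symm (e : Iso X Y) : Iso Y X := ⟨e.toEquiv.symm, e.smooth_symm, e.smooth⟩

def trans (e : Iso X Y) (f : Iso Y Z) : Iso X Z :=
  ⟨e.toEquiv.trans f.toEquiv, f.smooth.comp e.smooth, e.smooth_symm.comp f.smooth_symm⟩

end Iso

/-- The exponential functor on smooth maps, `f ↦ F ∘ f`. -/
def expMap {A B : FrolicherSpace.{u}} (Y : FrolicherSpace.{u}) (F : A → B) (hF : IsSmooth F)
    (f : exponential A Y) : exponential B Y :=
  (⟨F ∘ f.1, hF.comp f.2⟩ : SmoothMap Y B)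

theorem isSmooth_expMap {A B : FrolicherSpace.{u}} (Y : FrolicherSpace.{u}) {F : A → B}
    (hF : IsSmooth F) : IsSmooth (expMap Y F hF) := fun c hc =>
  (mem_curves_exponential _).2 fun σ hσ b hb =>
    hF _ ((mem_curves_exponential c).1 hc σ hσ b hb)

/-- An isomorphism `A ≅ B` induces `A ^ Y ≅ B ^ Y`. -/
def Iso.exp {A B : FrolicherSpace.{u}} (e : Iso A B) (Y : FrolicherSpace.{u}) :
    Iso (exponential A Y) (exponential B Y) where
  toEquiv :=
    { toFun := expMap Y e.toEquiv e.smooth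
      invFun := expMap Y e.toEquiv.symm e.smooth_symm
      left_inv := fun _ => Subtype.ext (funext fun _ => e.toEquiv.symm_apply_apply _)
      right_inv := fun _ => Subtype.ext (funext fun _ => e.toEquiv.apply_symm_apply _) }
  smooth := isSmooth_expMap Y e.smooth
  smooth_symm := isSmooth_expMap Y e.smooth_symm

/-- Composition of a plot with a smooth map. -/
def Plot.map {n : ℕ} {A : FrolicherSpace.{u}} {B : FrolicherSpace.{v}} (F : A → B)
    (hF : IsSmooth F) (f : Plot n A) : Plot n B :=
  ⟨F ∘ f.1, fun _ hχ => f.2 _ (hF.comp_mem_functions hχ)⟩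

/-- The functor `(-) ⊗ W` on smooth maps. -/
def Jet.mapSmooth {A : FrolicherSpace.{u}} {B : FrolicherSpace.{v}} (W : SmoothQuotient)
    (F : A → B) (hF : IsSmooth F) : prolong A W → prolong B W :=
  Quotient.map (Plot.map F hF) fun _ _ h =>
    ⟨congrArg F h.1, fun χ => h.2 ⟨_, hF.comp_mem_functions χ.2⟩⟩

theorem Jet.isSmooth_mapSmooth {A : FrolicherSpace.{u}} {B : FrolicherSpace.{v}}
    (W : SmoothQuotient) {F : A → B} (hF : IsSmooth F) : IsSmooth (Jet.mapSmooth W F hF) := by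
  rintro c hc _ ⟨χ, h, hh, rfl⟩
  have e : (h ∘ Jet.map χ) ∘ Jet.mapSmooth W F hF =
      h ∘ Jet.map ⟨_, hF.comp_mem_functions χ.2⟩ :=
    funext fun a => Quotient.inductionOn a fun _ => rfl
  exact (congrArg (fun k => ContDiff ℝ ∞ (k ∘ c)) e).mpr (hc _ ⟨_, h, hh, rfl⟩)

/-- An isomorphism `A ≅ B` induces `A ⊗ W ≅ B ⊗ W`. -/
def Iso.prolong {A : FrolicherSpace.{u}} {B : FrolicherSpace.{v}} (e : Iso A B)
    (W : SmoothQuotient) : Iso (A.prolong W) (B.prolong W) where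
  toEquiv :=
    { toFun := Jet.mapSmooth W e.toEquiv e.smooth
      invFun := Jet.mapSmooth W e.toEquiv.symm e.smooth_symm
      left_inv := fun a => by
        induction a using Quotient.inductionOn with | _ f
        exact congrArg (jet W) (Subtype.ext (funext fun x => e.toEquiv.symm_apply_apply _))
      right_inv := fun a => by
        induction a using Quotient.inductionOn with | _ f
        exact congrArg (jet W) (Subtype.ext (funext fun x => e.toEquiv.apply_symm_apply _)) }
  smooth := Jet.isSmooth_mapSmooth W e.smooth
  smooth_symm := Jet.isSmooth_mapSmooth W e.smooth_symm

/-- Composition of a plot with a selection of coordinates. -/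
def Plot.reindex {k n : ℕ} {X : FrolicherSpace.{u}} (e : Fin k → Fin n) (f : Plot k X) :
    Plot n X :=
  ⟨fun x => f.1 fun i => x (e i), fun χ hχ =>
    (f.2 χ hχ).comp (contDiff_pi.2 fun i => contDiff_apply ℝ ℝ (e i))⟩

/-- The map `X ⊗ V → X ⊗ W` induced by a selection of coordinates. -/
def Jet.reindex (X : FrolicherSpace.{u}) {V W : SmoothQuotient} (e : Fin V.dim → Fin W.dim)
    (h : V.ideal ≤ W.ideal.comap (smoothFunctions.pullback e)) : prolong X V → prolong X W :=
  Quotient.map (Plot.reindex e) fun _ _ hfg => ⟨hfg.1, fun χ => h (hfg.2 χ)⟩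

theorem Jet.isSmooth_reindex (X : FrolicherSpace.{u}) {V W : SmoothQuotient}
    (e : Fin V.dim → Fin W.dim) (h : V.ideal ≤ W.ideal.comap (smoothFunctions.pullback e)) :
    IsSmooth (Jet.reindex X e h) := by
  rintro c hc _ ⟨χ, g, hg, rfl⟩
  -- The induced map of algebras is linear, so it pulls linear functionals, and with them all
  -- functions on `W.space`, back to `V.space`.
  let q : V.Algebra →ₗ[ℝ] W.Algebra :=
    (Ideal.Quotient.liftₐ V.ideal ((Ideal.Quotient.mkₐ ℝ W.ideal).comp
      (smoothFunctions.pullback e)) fun a ha => Ideal.Quotient.eq_zero_iff_mem.2 (h ha)).toLinearMap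
  have hq : g ∘ q ∈ V.space.functions := by
    intro a ha
    refine hg (q ∘ a) ?_
    rintro _ ⟨l, hl⟩
    exact ha _ ⟨l ∘ₗ q, fun x => hl (q x)⟩
  have e' : (g ∘ Jet.map χ) ∘ Jet.reindex X e h = (g ∘ q) ∘ Jet.map χ :=
    funext fun a => Quotient.inductionOn a fun _ => rfl
  exact (congrArg (fun k => ContDiff ℝ ∞ (k ∘ c)) e').mpr (hc _ ⟨χ, g ∘ q, hq, rfl⟩)

/-- `ℝ ⊗_∞ W` lives on `0 + W.dim` coordinates, which is `W.dim` only up to a cast; hence the detour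
through reindexing. -/
theorem le_comap_tensor_real (W : SmoothQuotient) :
    W.ideal ≤ (SmoothQuotient.real.tensor W).ideal.comap
      (smoothFunctions.pullback (Fin.natAdd SmoothQuotient.real.dim)) :=
  fun _ hf => Ideal.mem_sup_right (Ideal.mem_map_of_mem _ hf)

theorem tensor_real_le_comap (W : SmoothQuotient) :
    (SmoothQuotient.real.tensor W).ideal ≤
      W.ideal.comap (smoothFunctions.pullback (Fin.cast (Nat.zero_add _))) :=
  sup_le (Ideal.map_le_iff_le_comap.2 bot_le) (Ideal.map_le_iff_le_comap.2 fun f hf => by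
    have e : smoothFunctions.pullback (Fin.cast (Nat.zero_add _))
        (smoothFunctions.pullback (Fin.natAdd 0) f) = f :=
      Subtype.ext (funext fun x => congrArg f.1 (funext fun i =>
        congrArg x (Fin.ext (Nat.zero_add _))))
    exact (congrArg (· ∈ W.ideal) e).mpr hf)

/-- `X ⊗ W ≅ X ⊗ (ℝ ⊗_∞ W)`. -/
def tensorRealIso (X : FrolicherSpace.{u}) (W : SmoothQuotient) :
    Iso (X.prolong W) (X.prolong (SmoothQuotient.real.tensor W)) where
  toEquiv :=
    { toFun := Jet.reindex X _ (le_comap_tensor_real W)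
      invFun := Jet.reindex X _ (tensor_real_le_comap W)
      left_inv := fun a => by
        induction a using Quotient.inductionOn with | _ f
        refine congrArg (jet W) (Subtype.ext (funext fun x => congrArg f.1 (funext fun i => ?_)))
        exact congrArg x (Fin.ext (Nat.zero_add _))
      right_inv := fun a => by
        induction a using Quotient.inductionOn with | _ f
        refine congrArg (jet (SmoothQuotient.real.tensor W))
          (Subtype.ext (funext fun x => congrArg f.1 (funext fun i => ?_)))
        exact congrArg x (Fin.ext (Nat.zero_add _)) }
  smooth := Jet.isSmooth_reindex X _ (le_comap_tensor_real W)
  smooth_symm := Jet.isSmooth_reindex X _ (tensor_real_le_comap W)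

/-- The constant plots. -/
def Plot.const {X : FrolicherSpace.{u}} (n : ℕ) (x : X) : Plot n X :=
  ⟨fun _ => x, fun _ _ => contDiff_const⟩

/-- The base point of a jet. -/
def Jet.base {X : FrolicherSpace.{u}} {W : SmoothQuotient} : Jet X W → X :=
  Quotient.lift (fun f : Plot W.dim X => f.1 0) fun _ _ h => h.1

/-- `X ≅ X ⊗ ℝ`. -/
def prolongRealIso (X : FrolicherSpace.{u}) : Iso X (X.prolong SmoothQuotient.real) where
  toEquiv :=
    { toFun := fun x => jet SmoothQuotient.real (Plot.const 0 x)
      invFun := Jet.base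
      left_inv := fun _ => rfl
      right_inv := fun a => by
        induction a using Quotient.inductionOn with | _ f
        exact congrArg (jet SmoothQuotient.real)
          (Subtype.ext (funext fun x => congrArg f.1 (funext fun i => i.elim0))) }
  smooth := by
    rintro c hc _ ⟨χ, h, hh, rfl⟩
    refine hh _ ?_
    rintro f ⟨l, hl⟩
    have e : ∀ x : X, f (Jet.map χ (jet SmoothQuotient.real (Plot.const 0 x))) = χ.1 x * l 1 :=
      fun x => by
        have h1 : Jet.map χ (jet SmoothQuotient.real (Plot.const 0 x)) =
            (χ.1 x • 1 : SmoothQuotient.real.Algebra) :=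
          congrArg (Ideal.Quotient.mk SmoothQuotient.real.ideal)
            (Subtype.ext (funext fun _ => (mul_one (χ.1 x)).symm))
        exact ((hl _).trans (congrArg l h1)).trans (l.map_smul (χ.1 x) 1)
    exact (congrArg (ContDiff ℝ ∞) (funext fun s => e (c s))).mpr
      (((X.mem_curves _).1 hc χ.1 χ.2).mul contDiff_const)
  smooth_symm := by
    intro c hc
    refine (X.mem_curves _).2 fun χ hχ => ?_
    let ev : SmoothQuotient.real.Algebra →ₗ[ℝ] ℝ :=
      (Ideal.Quotient.liftₐ SmoothQuotient.real.ideal (smoothFunctions.evalZero 0)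
        fun a ha => (congrArg (smoothFunctions.evalZero 0) (Ideal.mem_bot.1 ha)).trans
          (map_zero _)).toLinearMap
    have hev : (ev : SmoothQuotient.real.Algebra → ℝ) ∈ SmoothQuotient.real.space.functions :=
      fun a ha => ha _ ⟨ev, fun _ => rfl⟩
    have e : χ ∘ Jet.base (W := SmoothQuotient.real) = ev ∘ Jet.map ⟨χ, hχ⟩ :=
      funext fun a => Quotient.inductionOn a fun _ => rfl
    exact (congrArg (fun k => ContDiff ℝ ∞ (k ∘ c)) e).mpr (hc _ ⟨⟨χ, hχ⟩, _, hev, rfl⟩)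

/-! ### Currying and the chain of isomorphisms. -/

/-- The product of Frölicher spaces. -/
def prod (Y Z : FrolicherSpace.{u}) : FrolicherSpace.{u} :=
  ofFunctions {f : Y × Z → ℝ |
    (∃ χ ∈ Y.functions, f = χ ∘ Prod.fst) ∨ ∃ χ ∈ Z.functions, f = χ ∘ Prod.snd}

theorem mem_curves_prod {Y Z : FrolicherSpace.{u}} (c : ℝ → Y × Z) :
    c ∈ (prod Y Z).curves ↔ Prod.fst ∘ c ∈ Y.curves ∧ Prod.snd ∘ c ∈ Z.curves := by
  rw [Y.mem_curves, Z.mem_curves]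
  constructor
  · exact fun h => ⟨fun χ hχ => h _ (Or.inl ⟨χ, hχ, rfl⟩), fun χ hχ => h _ (Or.inr ⟨χ, hχ, rfl⟩)⟩
  · rintro ⟨h1, h2⟩ _ (⟨χ, hχ, rfl⟩ | ⟨χ, hχ, rfl⟩)
    · exact h1 χ hχ
    · exact h2 χ hχ

/-- `P ^ (Y × Z) ≅ (P ^ Y) ^ Z`. -/
def curryIso (P Y Z : FrolicherSpace.{u}) :
    Iso (exponential P (prod Y Z)) (exponential (exponential P Y) Z) where
  toEquiv :=
    { toFun := fun f : SmoothMap (prod Y Z) P =>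
        (⟨fun z => (⟨fun y => f.1 (y, z), fun b hb => f.2 (fun s => (b s, z))
          ((mem_curves_prod _).2 ⟨hb, const_mem_curves Z z⟩)⟩ : SmoothMap Y P),
          fun b' hb' => (mem_curves_exponential _).2 fun σ hσ b hb =>
            f.2 (fun s => (b s, b' (σ s)))
              ((mem_curves_prod _).2 ⟨hb, comp_mem_curves hb' hσ⟩)⟩ :
            SmoothMap Z (exponential P Y))
      invFun := fun f : SmoothMap Z (exponential P Y) =>
        (⟨fun p => (f.1 p.2).1 p.1, fun c hc =>
          (mem_curves_exponential _).1 (f.2 _ ((mem_curves_prod c).1 hc).2) id contDiff_id _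
            ((mem_curves_prod c).1 hc).1⟩ : SmoothMap (prod Y Z) P)
      left_inv := fun _ => rfl
      right_inv := fun _ => rfl }
  smooth := fun c hc => (mem_curves_exponential _).2 fun σ hσ b' hb' =>
    (mem_curves_exponential _).2 fun τ hτ b hb =>
      (mem_curves_exponential c).1 hc (σ ∘ τ) (hσ.comp hτ) (fun s => (b s, b' (τ s)))
        ((mem_curves_prod _).2 ⟨hb, comp_mem_curves hb' hτ⟩)
  smooth_symm := fun c hc => (mem_curves_exponential _).2 fun σ hσ b hb =>
    (mem_curves_exponential _).1
      ((mem_curves_exponential c).1 hc σ hσ _ ((mem_curves_prod b).1 hb).2) id contDiff_id _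
        ((mem_curves_prod b).1 hb).1

/-- If `X` is Weil-exponentiable, then `X ^ Y ⊗ W ≅ (X ⊗ W) ^ Y` canonically. -/
theorem WeilExponentiable.exists_iso {X : FrolicherSpace.{u}} (hX : X.WeilExponentiable)
    (Y : FrolicherSpace.{u}) {W : SmoothQuotient} (hW : W.IsWeil) :
    ∃ Ψ : Iso ((exponential X Y).prolong W) (exponential (X.prolong W) Y),
      ∀ (γ : Plot W.dim (exponential X Y)) (y : Y),
        (Ψ.toEquiv (jet W γ)).1 y = jet W (γ.eval y) := by
  -- With first algebra `ℝ` the law reads `(X ⊗ (ℝ ⊗_∞ W))^Y ≅ (X ⊗ ℝ)^Y ⊗ W`; both factors `ℝ` are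
  -- then removed.
  obtain ⟨Θ, hΘ, hΘ', hcan⟩ := hX Y _ W SmoothQuotient.isWeil_real hW
  let Θ' : Iso _ _ := ⟨Θ, hΘ, hΘ'⟩
  refine ⟨(((prolongRealIso X).exp Y).prolong W).trans
    (Θ'.symm.trans ((tensorRealIso X W).symm.exp Y)), fun γ y => ?_⟩
  obtain ⟨φ, g, hφ, hg, hφg⟩ := hcan (Plot.reindex (Fin.natAdd SmoothQuotient.real.dim) γ)
  have h1 : (((prolongRealIso X).exp Y).prolong W).toEquiv (jet W γ) = Θ φ := by
    rw [hφg]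
    refine congrArg (jet W) (Subtype.ext (funext fun t => Subtype.ext (funext fun y => ?_)))
    refine Eq.trans ?_ (hg t y).symm
    refine congrArg (jet SmoothQuotient.real) (Subtype.ext (funext fun x => ?_))
    exact congrArg (fun t => (γ.1 t).1 y) (funext fun i => (Fin.append_right x t i).symm)
  have h2 : Θ'.symm.toEquiv (Θ φ) = φ := Θ.symm_apply_apply φ
  change (((tensorRealIso X W).symm.exp Y).toEquiv (Θ'.symm.toEquiv
    ((((prolongRealIso X).exp Y).prolong W).toEquiv (jet W γ)))).1 y = _
  rw [h1, h2]
  change (tensorRealIso X W).toEquiv.symm (φ.1 y) = _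
  exact (Equiv.symm_apply_eq _).2 (hφ y)

end FrolicherSpace

end

open FrolicherSpace

theorem proposition4p3 (X : FrolicherSpace.{u}) (hX : X.WeilExponentiable)
    (Y : FrolicherSpace.{u}) : (FrolicherSpace.exponential X Y).WeilExponentiable := by
  intro Z W₁ W₂ hW₁ hW₂
  obtain ⟨Ψ, hΨ⟩ := hX.exists_iso Y (hW₁.tensor hW₂)
  obtain ⟨Ψ₁, hΨ₁⟩ := hX.exists_iso Y hW₁
  obtain ⟨Θ, hΘ, hΘ', hcan⟩ := hX (prod Y Z) W₁ W₂ hW₁ hW₂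
  let Θ' : Iso _ _ := ⟨Θ, hΘ, hΘ'⟩
  let e₁ := (Ψ.exp Z).trans (curryIso _ Y Z).symm
  let e₂ := ((curryIso (X.prolong W₁) Y Z).trans (Ψ₁.symm.exp Z))
  let e := e₁.trans (Θ'.trans (e₂.prolong W₂))
  refine ⟨e.toEquiv, e.smooth, e.smooth_symm, fun γ => ?_⟩
  -- Canonicity for `Y × Z` is applied to the uncurried plot; its two representatives are carried
  -- back along `e₁` and forward along `e₂`.
  obtain ⟨φ, g, hφ, hg, hφg⟩ := hcan (Plot.map _ (curryIso X Y Z).smooth_symm γ)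
  refine ⟨e₁.symm.toEquiv φ, Plot.map _ e₂.smooth g, fun z => ?_, fun t z => ?_, ?_⟩
  · change Ψ.toEquiv.symm (((curryIso _ Y Z).toEquiv φ).1 z) = _
    refine (Equiv.symm_apply_eq _).2 (Subtype.ext (funext fun y =>
      (hφ (y, z)).trans (hΨ (γ.eval z) y).symm))
  · change Ψ₁.toEquiv.symm (((curryIso _ Y Z).toEquiv (g.1 t)).1 z) = _
    refine (Equiv.symm_apply_eq _).2 (Subtype.ext (funext fun y =>
      (hg t (y, z)).trans (hΨ₁ ((γ.eval z).slice t) y).symm))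
  · change (e₂.prolong W₂).toEquiv (Θ (e₁.toEquiv (e₁.toEquiv.symm φ))) = _
    rw [Equiv.apply_symm_apply, hφg]
    rfl
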